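/- Let $n,p\ge 1$ be integers and let $\Sigma_1,\dots,\Sigma_n$ be real symmetric positive semidefinite $p\times p$ matrices. Let $\mathbb H=\{z\in\mathbb C:\operatorname{Im} z>0\}$. For every $z\in\mathbb H$ the system $$L_i=z-\frac1n\operatorname{tr}\Big(\Sigma_i\Big(I_p-\frac1n\sum_{j=1}^n\frac{\Sigma_j}{L_j}\Big)^{-1}\Big),\qquad 1\le i\le n,$$ has a unique solution $L\in\mathbb H^n$, denoted $\tilde\Lambda^z=(\tilde\Lambda^z_1,\dots,\tilde\Lambda^z_n)$, and $z\mapsto\tilde\Lambda^z$ is analytic on $\mathbb H$. Put $$\tilde R(z)=\Big(\frac1n\sum_{i=1}^n\frac{z\,\Sigma_i}{\tilde\Lambda_i^z}-zI_p\Big)^{-1},\qquad \tilde g(z)=\frac1p\operatorname{tr}\tilde R(z)\qquad(z\in\mathbb H).$$ Say that $f:\mathbb H\to\mathbb C$ is the Stieltjes transform of a finite measure $\mu$ on $\mathbb R$ if $f(z)=\int\frac{d\mu(\lambda)}{\lambda-z}$ for all $z\in\mathbb H$. (a) There is a probability measure $\tilde\mu$ on $\mathbb R$ whose support $\tilde S$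 is a compact subset of $\mathbb R_+=[0,\infty)$ and whose Stieltjes transform is $\tilde g$. For every $i$ there is a probability measure $\tilde\mu_i$ with support in $\mathbb R_+$ whose Stieltjes transform is $z\mapsto-1/\tilde\Lambda_i^z$, and $$\tilde\mu=\Big(1-\frac np\Big)\delta_0+\frac1p\sum_{i=1}^n\tilde\mu_i$$ (as signed measures: if $n>p$, the Dirac masses at $0$ of the $\tilde\mu_i$ cancel the negative term). (b) $\sup\tilde S\le O(1)$ in the following sense. For all constants $K,C,M\in\mathbb R$ and $c>0$ there is $B$, depending only on $K,C,c,M$, such that $\tilde S\subset[0,B]$ whenever $n,p\ge1$, $p\le Kn$ and $\Sigma_i=\mathbb E[x_ix_i^T]$, where $x_1,\dots,x_n$ are the columns of a random $p\times n$ real matrix $X$ such that $\|\mathbb E[x_i]\|\le M$ for all $i$ and $$\mathbb P\big(|f(X)-\mathbb E[f(X)]|\ge t\big)\le Ce^{-(t/c)^2}$$ for all $t>0$ and every real-valued $f$ that is $1$-Lipschitz for the Frobenius norm. -/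

import Mathlib

open MeasureTheory

namespace SampleCovariance

noncomputable section

/-- The matrix `(I_p - (1/n) ∑ i, Σ_i / L_i)⁻¹` attached to a diagonal matrix `L`, given by its diagonal
entries. -/
def tildeQ {n p : ℕ} (S : Fin n → Matrix (Fin p) (Fin p) ℝ) (L : Fin n → ℂ) :
    Matrix (Fin p) (Fin p) ℂ :=
  (1 - (1 / (n : ℂ)) • ∑ i, (1 / L i) • (S i).map Complex.ofReal)⁻¹

/-- `L` has its diagonal entries in the open upper half plane and solves
`L_i = z - (1/n) tr (Σ_i (I_p - (1/n) ∑ j, Σ_j / L_j)⁻¹)` for every `i`. -/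
def IsSolution {n p : ℕ} (S : Fin n → Matrix (Fin p) (Fin p) ℝ) (z : ℂ) (L : Fin n → ℂ) : Prop :=
  (∀ i, 0 < (L i).im) ∧
    ∀ i, L i = z - (1 / (n : ℂ)) * ((S i).map Complex.ofReal * tildeQ S L).trace

/-- The solution of the fixed point equation at `z`. (Existence and uniqueness for `z` in the upper half
plane is not built in.) -/
def tildeLambda {n p : ℕ} (S : Fin n → Matrix (Fin p) (Fin p) ℝ) (z : ℂ) : Fin n → ℂ :=
  Classical.epsilon (IsSolution S z)

/-- The matrix `((1/n) ∑ i, z Σ_i / Λ_i - z I_p)⁻¹`, where `Λ` solves the fixed point equation at `z`. -/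
def tildeR {n p : ℕ} (S : Fin n → Matrix (Fin p) (Fin p) ℝ) (z : ℂ) : Matrix (Fin p) (Fin p) ℂ :=
  ((1 / (n : ℂ)) • ∑ i, (z / tildeLambda S z i) • (S i).map Complex.ofReal - z • 1)⁻¹

/-- The function `z ↦ (1/p) tr (tildeR z)`. -/
def tildeG {n p : ℕ} (S : Fin n → Matrix (Fin p) (Fin p) ℝ) (z : ℂ) : ℂ :=
  (1 / (p : ℂ)) * (tildeR S z).trace

/-- On the upper half plane, `f` is the Stieltjes transform `z ↦ ∫ 1 / (x - z) dμ(x)` of `μ`. -/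
def IsStieltjesTransform (f : ℂ → ℂ) (μ : Measure ℝ) : Prop :=
  ∀ z : ℂ, 0 < z.im → f z = resolventTransform μ z

/-- Gaussian concentration of the random matrix `X`, with constants `C` and `c`, for all observables that
are `1`-Lipschitz with respect to the Frobenius norm. -/
def IsConcentrated {n p : ℕ} {Ω : Type*} [MeasurableSpace Ω] (P : Measure Ω)
    (X : Ω → Matrix (Fin p) (Fin n) ℝ) (C c : ℝ) : Prop :=
  ∀ f : Matrix (Fin p) (Fin n) ℝ → ℝ,
    (∀ A B, |f A - f B| ≤ Real.sqrt (∑ k, ∑ i, (A k i - B k i) ^ 2)) →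
    ∀ t : ℝ, 0 < t →
      P.real {ω | t ≤ |f (X ω) - ∫ ω', f (X ω') ∂P|} ≤ C * Real.exp (-(t / c) ^ 2)

/-- The matrix `Σ_i = E[x_i x_iᵀ]`, where `x_i` is the `i`-th column of `X`. -/
def secondMoment {n p : ℕ} {Ω : Type*} [MeasurableSpace Ω] (P : Measure Ω)
    (X : Ω → Matrix (Fin p) (Fin n) ℝ) (i : Fin n) : Matrix (Fin p) (Fin p) ℝ :=
  Matrix.of fun k l => ∫ ω, X ω k i * X ω l i ∂P

end

end SampleCovariance

/-! ### Cauchy's theorem and boundary values in the upper half plane. -/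

namespace SampleCovariance

open Filter Topology Complex Set
open scoped ComplexConjugate

/-! Write `A(L) = I - (1/n) ∑ Σ_j / L_j` and `Q = A⁻¹`, factor `Σ_i = N_iᵀ N_i`, and let `F` be the
map whose fixed points are the solutions. By the resolvent identity, `F(L) - F(L')` is a sum of
products of entries of the matrices `N_i Q N_jᵀ` at `L` and at `L'`. For `L' = conj L` this is an
exact formula for `Im F(L) - Im z` as a sum of nonnegative terms (`im_fixedPointMap`); for general
`L'`, Cauchy-Schwarz bounds the difference by the geometric mean of two such sums
(`norm_fixedPointMap_sub_sq_le`). Because `Im z > 0` is subtracted, `F` contracts the gauge `|L_i -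
L'_i| / (Im L_i Im L'_i)^(1/2)`. Uniqueness follows. The iterates of `F` from the constant vector
`z` stay bounded in the invariant region `Im L_i ≥ Im z`, `Im (L_i conj z) ≥ 0`, so they converge
geometrically, locally uniformly in `z`, and the limit `Λ` is holomorphic.

Let `σ` bound the norms of the `Σ_i` and `κ` bound `p / n`. For `|z| ≥ 4σ(1 + κ)` a Neumann-type
bound on `Q` gives `|Λ_i| ≥ |z| / 2`, and the formula for `Im F` gives `Im Λ_i ≤ 2 Im z`. Hence `-1
/ Λ_i` behaves at infinity like the transform of a compactly supported probability measure, and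
`exists_isStieltjesTransform` produces the measure as a weak limit of the densities `Im f(t + iε) /
π`. A real point near which the imaginary part of the transform is `O(Im z)` lies outside the
support: the bounds above exclude points beyond `4σ(1 + κ)`, and `Im (Λ_i conj z) ≥ 0` excludes
negative points.

The trace of `A Q = 1` writes `tildeG` as the transform of `(1 - n/p) δ₀ + (1/p) ∑ ν_i`. Only the
mass at the origin could be negative, and it is not, because `Re tr Q ≥ 0` on the imaginary axis.
The radius depends only on `σ` and `κ`; concentration bounds the second moments of the linear forms
`u · x_i`, hence `σ`, which gives (b). -/

/-- A bound by a multiple of `1 / ‖ζ‖ ^ 2` near infinity in the closed upper half plane can be made global. -/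
theorem exists_bound_of_decay {G : ℂ → ℂ} {C r : ℝ} (hc : ContinuousOn G {ζ | 0 ≤ ζ.im})
    (hb : ∀ ζ : ℂ, 0 ≤ ζ.im → r ≤ ‖ζ‖ → ‖G ζ‖ ≤ C / ‖ζ‖ ^ 2) :
    ∃ D : ℝ, 0 ≤ D ∧ ∀ ζ : ℂ, 0 ≤ ζ.im → ‖G ζ‖ ≤ D * (1 + ‖ζ‖ ^ 2)⁻¹ := by
  have hK : IsCompact (Metric.closedBall (0 : ℂ) (max r 1) ∩ {ζ | 0 ≤ ζ.im}) :=
    (isCompact_closedBall _ _).inter_right (isClosed_le continuous_const Complex.continuous_im)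
  obtain ⟨M, hM⟩ := hK.exists_bound_of_continuousOn (hc.mono inter_subset_right)
  have h1 : (1 : ℝ) ≤ max r 1 := le_max_right _ _
  refine ⟨max (M * (1 + max r 1 ^ 2)) (2 * |C|), le_max_of_le_right (by positivity), fun ζ hζ => ?_⟩
  rw [← div_eq_mul_inv, le_div_iff₀ (by positivity)]
  by_cases h : ‖ζ‖ ≤ max r 1
  · refine le_max_of_le_left ?_
    have hm := hM ζ ⟨by simpa using h, hζ⟩
    gcongr
    exact (norm_nonneg _).trans hm
  · refine le_max_of_le_right ?_
    push Not at h
    have h2 : 1 < ‖ζ‖ := h1.trans_lt h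
    have h3 := hb ζ hζ ((le_max_left _ _).trans h.le)
    calc ‖G ζ‖ * (1 + ‖ζ‖ ^ 2) ≤ (|C| / ‖ζ‖ ^ 2) * (2 * ‖ζ‖ ^ 2) := by
          gcongr
          · exact h3.trans (by gcongr; exact le_abs_self C)
          · nlinarith
      _ = 2 * |C| := by field_simp

theorem integrable_real_of_decay {G : ℂ → ℂ} {C r : ℝ} (hc : ContinuousOn G {ζ | 0 ≤ ζ.im})
    (hb : ∀ ζ : ℂ, 0 ≤ ζ.im → r ≤ ‖ζ‖ → ‖G ζ‖ ≤ C / ‖ζ‖ ^ 2) :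
    Integrable fun t : ℝ => G t := by
  obtain ⟨D, -, hD⟩ := exists_bound_of_decay hc hb
  have hcont : Continuous fun t : ℝ => G t :=
    hc.comp_continuous Complex.continuous_ofReal (by simp)
  refine (integrable_inv_one_add_sq.const_mul D).mono' hcont.aestronglyMeasurable ?_
  exact ae_of_all _ fun t => by simpa using hD t (by simp)

/-- The integral along the real line of a function that is holomorphic in the upper half plane,
continuous up to the boundary and decays quadratically vanishes. -/
theorem integral_real_eq_zero_of_decay {G : ℂ → ℂ} {C r : ℝ} (hc : ContinuousOn G {ζ | 0 ≤ ζ.im})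
    (hd : DifferentiableOn ℂ G {ζ | 0 < ζ.im})
    (hb : ∀ ζ : ℂ, 0 ≤ ζ.im → r ≤ ‖ζ‖ → ‖G ζ‖ ≤ C / ‖ζ‖ ^ 2) :
    ∫ t : ℝ, G t = 0 := by
  have hint := integrable_real_of_decay hc hb
  obtain ⟨D, hD0, hD⟩ := exists_bound_of_decay hc hb
  have hlim := intervalIntegral_tendsto_integral hint tendsto_neg_atTop_atBot tendsto_id
  refine tendsto_nhds_unique hlim (squeeze_zero_norm' (a := fun R : ℝ => 4 * D * R⁻¹) ?_ ?_)
  · filter_upwards [eventually_gt_atTop 0] with R hR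
    have hle : ∀ ζ : ℂ, 0 ≤ ζ.im → R ≤ ‖ζ‖ → ‖G ζ‖ ≤ D / R ^ 2 := fun ζ h1 h2 => by
      refine (hD ζ h1).trans ?_
      rw [div_eq_mul_inv]
      gcongr
      nlinarith
    have hrect := integral_boundary_rect_eq_zero_of_continuousOn_of_differentiableOn G
      (-R : ℂ) (R + R * I) (hc.mono fun ζ hζ => ?_) (hd.mono fun ζ hζ => ?_)
    · simp only [neg_re, ofReal_re, add_re, mul_re, I_re, mul_zero, ofReal_im, I_im, mul_one,
        sub_self, add_zero, neg_im, neg_zero, ofReal_zero, zero_mul, add_im, mul_im, zero_add] at hrect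
      have e : ∫ x in (-R)..R, G x = (∫ x in (-R)..R, G (x + R * I))
          - I • (∫ y in (0 : ℝ)..R, G (R + y * I)) + I • ∫ y in (0 : ℝ)..R, G ((-R : ℝ) + y * I) := by
        linear_combination (exp := 1) hrect
      have b1 : ‖∫ x in (-R)..R, G (x + R * I)‖ ≤ D / R ^ 2 * |R - -R| :=
        intervalIntegral.norm_integral_le_of_norm_le_const fun x _ => hle _ (by simp [hR.le]) <| by
          simpa [abs_of_pos hR] using Complex.abs_im_le_norm ((x : ℂ) + R * I)
      have b2 : ‖∫ y in (0 : ℝ)..R, G (R + y * I)‖ ≤ D / R ^ 2 * |R - 0| :=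
        intervalIntegral.norm_integral_le_of_norm_le_const fun x hx => by
          rw [uIoc_of_le hR.le] at hx
          refine hle _ (by simp [hx.1.le]) ?_
          simpa [abs_of_pos hR] using Complex.abs_re_le_norm ((R : ℂ) + x * I)
      have b3 : ‖∫ y in (0 : ℝ)..R, G ((-R : ℝ) + y * I)‖ ≤ D / R ^ 2 * |R - 0| :=
        intervalIntegral.norm_integral_le_of_norm_le_const fun x hx => by
          rw [uIoc_of_le hR.le] at hx
          refine hle _ (by simp [hx.1.le]) ?_
          simpa [abs_of_pos hR] using Complex.abs_re_le_norm (((-R : ℝ) : ℂ) + x * I)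
      have a1 : |R - -R| = 2 * R := by rw [abs_of_pos] <;> linarith
      have a2 : |R - 0| = R := by rw [sub_zero, abs_of_pos hR]
      rw [a1] at b1
      rw [a2] at b2 b3
      simp only [id_eq]
      rw [e]
      refine (norm_add_le _ _).trans ((add_le_add_left (norm_sub_le _ _) _).trans ?_)
      simp only [norm_smul, norm_I, one_mul]
      have : 4 * D * R⁻¹ = D / R ^ 2 * (2 * R) + D / R ^ 2 * R + D / R ^ 2 * R := by
        field_simp; ring
      linarith
    · have := hζ.2
      simp only [neg_im, ofReal_im, neg_zero, add_im, mul_im, ofReal_re, I_im, mul_one, I_re,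
        mul_zero, add_zero, zero_add, mem_preimage] at this
      rw [uIcc_of_le hR.le] at this
      exact this.1
    · have := hζ.2
      simp only [neg_im, ofReal_im, neg_zero, add_im, mul_im, ofReal_re, I_im, mul_one, I_re,
        mul_zero, add_zero, zero_add, mem_preimage] at this
      rw [min_eq_left hR.le] at this
      exact this.1
  · simpa using tendsto_inv_atTop_zero.const_mul (4 * D)

/-- The integrand is the Poisson kernel of the half plane at `w`; a translation and a scaling reduce
it to `1 / (1 + t ^ 2)`. -/
theorem integral_poisson {w : ℂ} (hw : 0 < w.im) :
    ∫ t : ℝ, (w.im : ℂ) / ((t - w) * (t - conj w)) = Real.pi := by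
  have h : ∀ t : ℝ, (w.im : ℂ) / ((t - w) * (t - conj w))
      = ((w.im⁻¹ * (1 + ((t - w.re) / w.im) ^ 2)⁻¹ : ℝ) : ℂ) := fun t => by
    have : ((t : ℂ) - w) * (t - conj w) = (((t - w.re) ^ 2 + w.im ^ 2 : ℝ) : ℂ) := by
      apply Complex.ext
      · simp [pow_two]
      · simp [pow_two]; ring
    rw [this, ← ofReal_div]
    congr 1
    field_simp
    ring
  simp_rw [h]
  rw [integral_complex_ofReal, integral_const_mul]
  have h2 := integral_sub_right_eq_self (fun t : ℝ => (1 + (t / w.im) ^ 2)⁻¹) (μ := volume) w.re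
  rw [h2, Measure.integral_comp_div (fun t : ℝ => (1 + t ^ 2)⁻¹) w.im, integral_univ_inv_one_add_sq,
    abs_of_pos hw, smul_eq_mul, inv_mul_cancel_left₀ hw.ne']

/-- A function holomorphic in a neighbourhood of the closed upper half plane that decays at infinity is
`1 / π` times the Cauchy transform of the boundary values of its imaginary part. -/
theorem integral_im_div_sub {F : ℂ → ℂ} {ε M r : ℝ} (hε : 0 < ε)
    (hF : DifferentiableOn ℂ F {ζ | -ε < ζ.im})
    (hb : ∀ ζ : ℂ, 0 ≤ ζ.im → r ≤ ‖ζ‖ → ‖F ζ‖ ≤ M / ‖ζ‖) {w : ℂ} (hw : 0 < w.im) :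
    ∫ t : ℝ, ((F t).im : ℂ) / (t - w) = Real.pi * F w := by
  have hsub : {ζ : ℂ | 0 ≤ ζ.im} ⊆ {ζ : ℂ | -ε < ζ.im} := fun ζ hζ =>
    (neg_lt_zero.2 hε).trans_le hζ
  have hopen : IsOpen {ζ : ℂ | -ε < ζ.im} := isOpen_lt continuous_const Complex.continuous_im
  have hwmem : {ζ : ℂ | -ε < ζ.im} ∈ 𝓝 w := hopen.mem_nhds (hsub hw.le)
  have hconj : ∀ ζ : ℂ, 0 ≤ ζ.im → ζ - conj w ≠ 0 := fun ζ hζ h => by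
    have := congrArg Complex.im h
    simp at this
    linarith
  have hreal : ∀ t : ℝ, (t : ℂ) - w ≠ 0 := fun t h => by
    have := congrArg Complex.im h
    simp at this
    linarith
  have hreal' : ∀ t : ℝ, (t : ℂ) - conj w ≠ 0 := fun t => hconj t (by simp)
  have hinv : DifferentiableOn ℂ (fun ζ : ℂ => ζ - conj w) {ζ | 0 ≤ ζ.im} := by fun_prop
  have hlarge : ∀ ζ u : ℂ, ‖u‖ = ‖w‖ → 2 * ‖w‖ + 1 ≤ ‖ζ‖ → ‖ζ‖ / 2 ≤ ‖ζ - u‖ := fun ζ u h1 h2 => by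
    have := norm_sub_norm_le ζ u
    rw [h1] at this
    linarith
  set r' := max r (2 * ‖w‖ + 1) with hr'
  have hpos : ∀ ζ : ℂ, r' ≤ ‖ζ‖ → 0 < ‖ζ‖ := fun ζ h => by
    have := (le_max_right r (2 * ‖w‖ + 1)).trans h
    have := norm_nonneg w
    linarith
  -- the Cauchy transform of the boundary values at the reflected point vanishes
  have d1 : DifferentiableOn ℂ (fun ζ => F ζ / (ζ - conj w)) {ζ | 0 ≤ ζ.im} :=
    (hF.mono hsub).div hinv hconj
  have b1 : ∀ ζ : ℂ, 0 ≤ ζ.im → r' ≤ ‖ζ‖ → ‖F ζ / (ζ - conj w)‖ ≤ 2 * M / ‖ζ‖ ^ 2 := by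
    intro ζ h1 h2
    have hp := hpos ζ h2
    have h3 := hb ζ h1 ((le_max_left _ _).trans h2)
    have h4 := hlarge ζ (conj w) (by simp) ((le_max_right _ _).trans h2)
    rw [norm_div]
    calc ‖F ζ‖ / ‖ζ - conj w‖ ≤ (M / ‖ζ‖) / (‖ζ‖ / 2) :=
          div_le_div₀ ((norm_nonneg _).trans h3) h3 (by positivity) h4
      _ = 2 * M / ‖ζ‖ ^ 2 := by field_simp
  have i1 := integrable_real_of_decay d1.continuousOn b1
  have e1 := integral_real_eq_zero_of_decay d1.continuousOn (d1.mono fun ζ (h : 0 < ζ.im) => h.le) b1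
  -- The difference quotient removes the pole at `w`. Writing `F t = F w + (t - w) * dslope F w t`,
  -- the first term is integrated against the Poisson kernel and the second contributes a
  -- holomorphic function with vanishing integral.
  have d2 : DifferentiableOn ℂ (fun ζ => dslope F w ζ / (ζ - conj w)) {ζ | 0 ≤ ζ.im} :=
    (((differentiableOn_dslope hwmem).2 hF).mono hsub).div hinv hconj
  have b2 : ∀ ζ : ℂ, 0 ≤ ζ.im → max r' 1 ≤ ‖ζ‖ →
      ‖dslope F w ζ / (ζ - conj w)‖ ≤ 4 * (|M| + ‖F w‖) / ‖ζ‖ ^ 2 := by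
    intro ζ h1 h2
    have h2' := (le_max_left _ _).trans h2
    have h1' : 1 ≤ ‖ζ‖ := (le_max_right _ _).trans h2
    have hp := hpos ζ h2'
    have h3 := hb ζ h1 ((le_max_left _ _).trans h2')
    have h4 := hlarge ζ (conj w) (by simp) ((le_max_right _ _).trans h2')
    have h5 := hlarge ζ w rfl ((le_max_right _ _).trans h2')
    have hne : ζ ≠ w := by
      rintro rfl
      rw [sub_self, norm_zero] at h5
      linarith
    have h6 : ‖F ζ - F w‖ ≤ |M| + ‖F w‖ := by
      refine (norm_sub_le _ _).trans (add_le_add_left (h3.trans ?_) _)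
      rw [div_le_iff₀ hp]
      nlinarith [le_abs_self M, abs_nonneg M]
    rw [dslope_of_ne _ hne, slope_def_field, norm_div, norm_div]
    calc ‖F ζ - F w‖ / ‖ζ - w‖ / ‖ζ - conj w‖ ≤ (|M| + ‖F w‖) / (‖ζ‖ / 2) / (‖ζ‖ / 2) := by gcongr
      _ = 4 * (|M| + ‖F w‖) / ‖ζ‖ ^ 2 := by field_simp; norm_num
  have i2 := integrable_real_of_decay d2.continuousOn b2
  have e2 := integral_real_eq_zero_of_decay d2.continuousOn (d2.mono fun ζ (h : 0 < ζ.im) => h.le) b2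
  have ip : Integrable fun t : ℝ => (w.im : ℂ) / ((t - w) * (t - conj w)) := by
    by_contra h
    have := integral_poisson hw
    rw [integral_undef h] at this
    exact Real.pi_ne_zero (by exact_mod_cast this.symm)
  -- the values at `w`
  have key : ∀ t : ℝ, ((F t).im : ℂ) / (t - w) =
      (w.im : ℂ) * (dslope F w t / (t - conj w)) + F w * ((w.im : ℂ) / ((t - w) * (t - conj w)))
      + (1 / (2 * I)) * (F t / (t - conj w)) - (1 / (2 * I)) * conj (F t / (t - conj w)) := by
    intro t
    have hne : (t : ℂ) ≠ w := fun h => hreal t (by rw [h, sub_self])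
    rw [dslope_of_ne _ hne, slope_def_field]
    have hFt : ((F t).im : ℂ) = (F t - conj (F t)) / (2 * I) := by
      rw [Complex.sub_conj]; field_simp; push_cast; ring
    have hwi : (w.im : ℂ) = (w - conj w) / (2 * I) := by
      rw [Complex.sub_conj]; field_simp; push_cast; ring
    have h1 := hreal t
    have h2 := hreal' t
    rw [hFt, hwi, map_div₀, map_sub, conj_conj, conj_ofReal]
    field_simp
    ring
  have i1' : Integrable fun t : ℝ => conj (F t / ((t : ℂ) - conj w)) :=
    (LinearIsometryEquiv.integrable_comp_iff Complex.conjLIE).2 i1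
  have e1' : ∫ t : ℝ, conj (F t / ((t : ℂ) - conj w)) = 0 := by
    rw [integral_conj, e1, map_zero]
  simp_rw [key]
  rw [integral_sub, integral_add, integral_add, integral_const_mul, integral_const_mul,
    integral_const_mul, integral_const_mul, e1, e1', e2, integral_poisson hw]
  · ring
  · exact i2.const_mul _
  · exact ip.const_mul _
  · exact (i2.const_mul _).add (ip.const_mul _)
  · exact i1.const_mul _
  · exact ((i2.const_mul _).add (ip.const_mul _)).add (i1.const_mul _)
  · exact i1'.const_mul _

end SampleCovariance

/-! ### Stieltjes transforms: local mass, support and atoms. -/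

namespace SampleCovariance

open Filter Topology Complex Set
open scoped ComplexConjugate

theorem resolventTransform_eq_integral_inv (μ : Measure ℝ) (z : ℂ) :
    resolventTransform μ z = ∫ x : ℝ, ((x : ℂ) - z)⁻¹ ∂μ := by
  simp [resolventTransform_apply, resolvent, Ring.inverse_eq_inv']

theorem norm_inv_ofReal_sub_le {z : ℂ} (hz : 0 < z.im) (x : ℝ) : ‖((x : ℂ) - z)⁻¹‖ ≤ z.im⁻¹ := by
  rw [norm_inv]
  gcongr
  simpa [abs_of_pos hz] using Complex.abs_im_le_norm ((x : ℂ) - z)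

theorem ofReal_sub_ne_zero {z : ℂ} (hz : 0 < z.im) (x : ℝ) : (x : ℂ) - z ≠ 0 := fun h => by
  have := congrArg Complex.im h
  simp at this
  linarith

theorem continuous_inv_ofReal_sub {z : ℂ} (hz : 0 < z.im) :
    Continuous fun x : ℝ => ((x : ℂ) - z)⁻¹ :=
  (by fun_prop : Continuous fun x : ℝ => (x : ℂ) - z).inv₀ (ofReal_sub_ne_zero hz)

theorem integrable_inv_ofReal_sub (μ : Measure ℝ) [IsFiniteMeasure μ] {z : ℂ} (hz : 0 < z.im) :
    Integrable (fun x : ℝ => ((x : ℂ) - z)⁻¹) μ :=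
  (integrable_const z.im⁻¹).mono' (continuous_inv_ofReal_sub hz).aestronglyMeasurable
    (ae_of_all _ (norm_inv_ofReal_sub_le hz))

theorem im_inv_ofReal_sub (x : ℝ) (z : ℂ) :
    (((x : ℂ) - z)⁻¹).im = z.im / ((x - z.re) ^ 2 + z.im ^ 2) := by
  rw [Complex.inv_im, Complex.normSq_apply]
  simp
  ring

theorem im_resolventTransform (μ : Measure ℝ) [IsFiniteMeasure μ] {z : ℂ} (hz : 0 < z.im) :
    (resolventTransform μ z).im = ∫ x : ℝ, z.im / ((x - z.re) ^ 2 + z.im ^ 2) ∂μ := by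
  rw [resolventTransform_eq_integral_inv]
  simp_rw [← im_inv_ofReal_sub]
  exact (integral_im (𝕜 := ℂ) (integrable_inv_ofReal_sub μ hz)).symm

/-- A measure puts mass at most `2 y Im S(x + i y)` on the interval of radius `y` around `x`, where `S` is
its Stieltjes transform. -/
theorem measureReal_Icc_le_im_resolventTransform (μ : Measure ℝ) [IsFiniteMeasure μ] {z : ℂ}
    (hz : 0 < z.im) :
    μ.real (Icc (z.re - z.im) (z.re + z.im)) ≤ 2 * z.im * (resolventTransform μ z).im := by
  have hi : Integrable (fun x : ℝ => z.im / ((x - z.re) ^ 2 + z.im ^ 2)) μ := by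
    simp_rw [← im_inv_ofReal_sub]
    exact (integrable_inv_ofReal_sub μ hz).im
  -- On this interval `|x - Re z| ≤ Im z`, so the Poisson kernel is at least `1 / (2 Im z)`.
  have h : (2 * z.im)⁻¹ * μ.real (Icc (z.re - z.im) (z.re + z.im))
      ≤ (resolventTransform μ z).im := by
    rw [im_resolventTransform μ hz, mul_comm, ← smul_eq_mul, ← integral_indicator_const _ measurableSet_Icc]
    refine integral_mono ((integrable_const _).indicator measurableSet_Icc) hi fun x => ?_
    by_cases hx : x ∈ Icc (z.re - z.im) (z.re + z.im)
    · simp only [hx, indicator_of_mem]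
      rw [inv_eq_one_div, div_le_div_iff₀ (by positivity) (by positivity)]
      have : (x - z.re) ^ 2 ≤ z.im ^ 2 := by
        apply sq_le_sq'
        · linarith [hx.1]
        · linarith [hx.2]
      nlinarith
    · simp only [hx, not_false_eq_true, indicator_of_notMem]
      positivity
  rwa [inv_mul_le_iff₀ (by positivity)] at h

/-- A measure vanishes near a point where the imaginary part of its Stieltjes transform is bounded by a
multiple of the distance to the real line. -/
theorem notMem_support_of_im_le (μ : Measure ℝ) [IsFiniteMeasure μ] {x₀ C δ : ℝ} (hδ : 0 < δ)
    (h : ∀ z : ℂ, 0 < z.im → z.im < δ → |z.re - x₀| < δ → (resolventTransform μ z).im ≤ C * z.im) :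
    x₀ ∉ μ.support := by
  -- The mass of an interval is at most a constant times the square of its length. Each bisection
  -- therefore halves the bound, and in the limit the mass is zero.
  have hstep : ∀ n : ℕ, ∀ a b : ℝ, a < b → x₀ - δ < a → b < x₀ + δ →
      μ.real (Ioc a b) ≤ C / 2 * (b - a) ^ 2 / 2 ^ n := by
    intro n
    induction n with
    | zero =>
      intro a b hab ha hb
      have hz : 0 < ((⟨(a + b) / 2, (b - a) / 2⟩ : ℂ)).im := by simpa using hab
      have h1 := measureReal_Icc_le_im_resolventTransform μ hz
      have h2 := h ⟨(a + b) / 2, (b - a) / 2⟩ hz (by simp only; linarith)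
        (by simp only [abs_lt]; constructor <;> linarith)
      simp only at h1 h2 hz
      have h3 : μ.real (Ioc a b) ≤ μ.real (Icc ((a + b) / 2 - (b - a) / 2) ((a + b) / 2 + (b - a) / 2)) :=
        measureReal_mono (fun x hx => ⟨by linarith [hx.1], by linarith [hx.2]⟩)
      have h4 := mul_le_mul_of_nonneg_left h2 (by linarith : 0 ≤ 2 * ((b - a) / 2))
      calc μ.real (Ioc a b) ≤ _ := h3.trans (h1.trans h4)
        _ = C / 2 * (b - a) ^ 2 / 2 ^ 0 := by ring
    | succ n ih =>
      intro a b hab ha hb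
      have h1 := ih a ((a + b) / 2) (by linarith) ha (by linarith)
      have h2 := ih ((a + b) / 2) b (by linarith) (by linarith) hb
      have h3 : μ.real (Ioc a b) ≤ μ.real (Ioc a ((a + b) / 2)) + μ.real (Ioc ((a + b) / 2) b) := by
        rw [← Ioc_union_Ioc_eq_Ioc (by linarith : a ≤ (a + b) / 2) (by linarith : (a + b) / 2 ≤ b)]
        exact measureReal_union_le _ _
      refine h3.trans ((add_le_add h1 h2).trans_eq ?_)
      rw [pow_succ]
      field_simp
      ring
  have hzero : μ.real (Ioc (x₀ - δ / 2) (x₀ + δ / 2)) = 0 := by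
    refine le_antisymm (ge_of_tendsto' (x := atTop) ?_ fun n =>
      hstep n _ _ (by linarith) (by linarith) (by linarith)) measureReal_nonneg
    simpa [div_eq_mul_inv] using (tendsto_pow_atTop_nhds_zero_of_lt_one (r := (2 : ℝ)⁻¹)
      (by norm_num) (by norm_num)).const_mul (C / 2 * (x₀ + δ / 2 - (x₀ - δ / 2)) ^ 2)
  rw [Measure.notMem_support_iff_exists]
  refine ⟨_, Ioc_mem_nhds (by linarith : x₀ - δ / 2 < x₀) (by linarith : x₀ < x₀ + δ / 2), ?_⟩
  rwa [measureReal_eq_zero_iff] at hzero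

/-- This is the uniform domination needed to pass to the limit, both as `y → ∞` and as `y → 0`. -/
theorem norm_mul_inv_ofReal_sub_le_one (y t : ℝ) : ‖-(y * I) * ((t : ℂ) - y * I)⁻¹‖ ≤ 1 := by
  rw [norm_mul, norm_neg, norm_inv, ← div_eq_mul_inv]
  refine div_le_one_of_le₀ ?_ (norm_nonneg _)
  simpa using Complex.abs_im_le_norm ((t : ℂ) - y * I)

theorem neg_mul_resolventTransform (μ : Measure ℝ) (y : ℝ) :
    -(y * I) * resolventTransform μ (y * I : ℂ) = ∫ t : ℝ, -(y * I) * ((t : ℂ) - y * I)⁻¹ ∂μ := by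
  rw [resolventTransform_eq_integral_inv, integral_const_mul]

/-- The total mass is read off from the Stieltjes transform at infinity. -/
theorem tendsto_neg_mul_resolventTransform_atTop (μ : Measure ℝ) [IsFiniteMeasure μ] :
    Tendsto (fun y : ℝ => -(y * I) * resolventTransform μ (y * I : ℂ)) atTop (𝓝 (μ.real univ)) := by
  simp_rw [neg_mul_resolventTransform]
  have h1 : (μ.real univ : ℂ) = ∫ _ : ℝ, (1 : ℂ) ∂μ := by simp
  rw [h1]
  refine tendsto_integral_filter_of_dominated_convergence (fun _ => 1) ?_ ?_ (integrable_const _) ?_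
  · filter_upwards [eventually_gt_atTop 0] with y hy
    exact ((continuous_inv_ofReal_sub (z := y * I) (by simpa using hy)).const_mul _).aestronglyMeasurable
  · exact .of_forall fun y => ae_of_all _ (norm_mul_inv_ofReal_sub_le_one y)
  · refine ae_of_all _ fun t => ?_
    have h2 : Tendsto (fun y : ℝ => (1 + t * I * ((y⁻¹ : ℝ) : ℂ))⁻¹) atTop (𝓝 1) := by
      have : Tendsto (fun y : ℝ => 1 + t * I * ((y⁻¹ : ℝ) : ℂ)) atTop (𝓝 (1 + t * I * ((0 : ℝ) : ℂ))) :=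
        ((Complex.continuous_ofReal.tendsto _).comp tendsto_inv_atTop_zero).const_mul _ |>.const_add _
      simpa using this.inv₀ (by simp)
    refine h2.congr' ?_
    filter_upwards [eventually_gt_atTop 0] with y hy
    have hy' : (y : ℂ) ≠ 0 := by exact_mod_cast hy.ne'
    have h3 : (t : ℂ) - y * I = -(y * I) * (1 + t * I * ((y⁻¹ : ℝ) : ℂ)) := by
      push_cast
      field_simp
      linear_combination (t : ℂ) * I_sq
    rw [h3, mul_inv, mul_inv_cancel_left₀]
    exact neg_ne_zero.2 (mul_ne_zero hy' I_ne_zero)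

/-- The mass at the origin is read off from the Stieltjes transform near the origin. -/
theorem tendsto_neg_mul_resolventTransform_zero (μ : Measure ℝ) [IsFiniteMeasure μ] :
    Tendsto (fun y : ℝ => -(y * I) * resolventTransform μ (y * I : ℂ)) (𝓝[>] 0) (𝓝 (μ.real {0})) := by
  simp_rw [neg_mul_resolventTransform]
  have h1 : (μ.real {0} : ℂ) = ∫ t : ℝ, ({0} : Set ℝ).indicator (fun _ => (1 : ℂ)) t ∂μ := by
    rw [integral_indicator_const _ (measurableSet_singleton _)]
    simp
  rw [h1]
  refine tendsto_integral_filter_of_dominated_convergence (fun _ => 1) ?_ ?_ (integrable_const _) ?_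
  · filter_upwards [self_mem_nhdsWithin] with y hy
    exact ((continuous_inv_ofReal_sub (z := y * I) (by simpa using hy)).const_mul _).aestronglyMeasurable
  · exact .of_forall fun y => ae_of_all _ (norm_mul_inv_ofReal_sub_le_one y)
  · refine ae_of_all _ fun t => ?_
    by_cases ht : t = 0
    · subst ht
      refine tendsto_const_nhds.congr' ?_
      filter_upwards [self_mem_nhdsWithin] with y hy
      have hy' : (y : ℂ) * I ≠ 0 := mul_ne_zero (by exact_mod_cast (ne_of_gt hy)) I_ne_zero
      rw [indicator_of_mem (mem_singleton _), ofReal_zero, zero_sub, mul_inv_cancel₀ (neg_ne_zero.2 hy')]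
    · have ht' : (t : ℂ) - ((0 : ℝ) : ℂ) * I ≠ 0 := by simpa using ht
      have h2 : ContinuousAt (fun y : ℝ => -(y * I) * ((t : ℂ) - y * I)⁻¹) 0 :=
        ContinuousAt.mul (by fun_prop) (ContinuousAt.inv₀ (by fun_prop) ht')
      have h3 := h2.tendsto.mono_left (nhdsWithin_le_nhds (s := Ioi 0))
      simpa [ht] using h3

end SampleCovariance

/-! ### Existence of a representing probability measure. -/

namespace SampleCovariance

open Filter Topology Complex Set
open scoped ComplexConjugate NNReal ENNReal

/-- The measure with density `Im f(t + i ε) / π`. -/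
noncomputable def boundaryMeasure (f : ℂ → ℂ) (ε : ℝ) : Measure ℝ :=
  volume.withDensity fun t : ℝ => ENNReal.ofReal ((f (t + ε * I)).im / Real.pi)

section

variable {f : ℂ → ℂ} {B M C : ℝ} (hf : DifferentiableOn ℂ f {z | 0 < z.im})

theorem norm_le_norm_add_mul_I {ζ : ℂ} (hζ : 0 ≤ ζ.im) {ε : ℝ} (hε : 0 ≤ ε) : ‖ζ‖ ≤ ‖ζ + ε * I‖ := by
  rw [Complex.norm_def, Complex.norm_def]
  refine Real.sqrt_le_sqrt ?_
  simp only [Complex.normSq_apply, add_re, mul_re, ofReal_re, I_re, mul_zero, ofReal_im, I_im, mul_one,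
    sub_self, add_zero, add_im, mul_im]
  nlinarith

include hf in
theorem continuous_im_boundary {ε : ℝ} (hε : 0 < ε) : Continuous fun t : ℝ => (f (t + ε * I)).im :=
  Complex.continuous_im.comp (hf.continuousOn.comp_continuous (by fun_prop) fun t => by simpa using hε)

include hf in
theorem integral_boundaryMeasure (him : ∀ z : ℂ, 0 < z.im → 0 ≤ (f z).im)
    {ε : ℝ} (hε : 0 < ε) (g : ℝ → ℂ) :
    ∫ t, g t ∂boundaryMeasure f ε = (Real.pi : ℂ)⁻¹ * ∫ t : ℝ, ((f (t + ε * I)).im : ℂ) * g t := by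
  have hm : Measurable fun t : ℝ => ENNReal.ofReal ((f (t + ε * I)).im / Real.pi) :=
    ((continuous_im_boundary hf hε).div_const _).measurable.ennreal_ofReal
  rw [boundaryMeasure, integral_withDensity_eq_integral_toReal_smul hm (ae_of_all _ fun _ => by simp),
    ← integral_const_mul]
  refine integral_congr_ae (ae_of_all _ fun t => ?_)
  have h0 := him (t + ε * I) (by simpa using hε)
  simp only [Complex.real_smul]
  rw [ENNReal.toReal_ofReal (by positivity)]
  push_cast
  ring

include hf in
-- The shifted function `f (· + iε)` is holomorphic across the real line, so the Cauchy
-- representation `integral_im_div_sub` applies to it without any boundary regularity of `f`.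
theorem resolventTransform_boundaryMeasure (him : ∀ z : ℂ, 0 < z.im → 0 ≤ (f z).im)
    (hM : ∀ z : ℂ, 0 < z.im → B ≤ ‖z‖ → ‖f z‖ ≤ M / ‖z‖) {ε : ℝ} (hε : 0 < ε)
    {w : ℂ} (hw : 0 < w.im) :
    resolventTransform (boundaryMeasure f ε) w = f (w + ε * I) := by
  rw [resolventTransform_eq_integral_inv, integral_boundaryMeasure hf him hε]
  have hF : DifferentiableOn ℂ (fun ζ => f (ζ + ε * I)) {ζ | -ε < ζ.im} :=
    hf.comp (by fun_prop) fun ζ (hζ : -ε < ζ.im) => by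
      simp only [mem_ofPred_eq, add_im, mul_im, ofReal_re, I_im, mul_one, ofReal_im, I_re, mul_zero, add_zero]
      linarith
  have hb : ∀ ζ : ℂ, 0 ≤ ζ.im → max B 1 ≤ ‖ζ‖ → ‖f (ζ + ε * I)‖ ≤ |M| / ‖ζ‖ := fun ζ h1 h2 => by
    have h3 := norm_le_norm_add_mul_I h1 hε.le
    have h4 : 0 < ‖ζ‖ := one_pos.trans_le ((le_max_right _ _).trans h2)
    refine (hM _ (by simp; linarith) ((le_max_left _ _).trans (h2.trans h3))).trans ?_
    gcongr
    exact le_abs_self M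
  have h := integral_im_div_sub hε hF hb hw
  simp only [div_eq_mul_inv] at h
  rw [h, inv_mul_cancel_left₀ (by exact_mod_cast Real.pi_ne_zero)]

/-- A finite measure that dominates the measures `boundaryMeasure f ε` near infinity. -/
noncomputable def dominatingMeasure (C : ℝ) : Measure ℝ :=
  volume.withDensity fun t : ℝ => ENNReal.ofReal (C * (1 + t ^ 2)⁻¹)

instance (C : ℝ) : IsFiniteMeasure (dominatingMeasure C) :=
  isFiniteMeasure_withDensity_ofReal (integrable_inv_one_add_sq.const_mul C).2

/-- At height `ε ≤ 1` and far out, `Im f ≤ C ε / t ^ 2 ≤ 2 C / (1 + t ^ 2)`. The bound does not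
depend on `ε`, which makes the family tight. -/
theorem boundaryMeasure_le_dominatingMeasure (hC0 : 0 ≤ C)
    (hC : ∀ z : ℂ, 0 < z.im → B ≤ ‖z‖ → (f z).im ≤ C * z.im / ‖z‖ ^ 2) {ε : ℝ} (hε : 0 < ε) (hε1 : ε ≤ 1)
    {s : Set ℝ} (hs : MeasurableSet s) (hsB : ∀ t ∈ s, max B 1 ≤ |t|) :
    boundaryMeasure f ε s ≤ dominatingMeasure (2 * C) s := by
  rw [boundaryMeasure, dominatingMeasure, withDensity_apply _ hs, withDensity_apply _ hs]
  refine setLIntegral_mono' hs fun t ht => ENNReal.ofReal_le_ofReal ?_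
  have h1 := hsB t ht
  have h2 : |t| ≤ ‖(t : ℂ) + ε * I‖ := by
    simpa using norm_le_norm_add_mul_I (ζ := (t : ℂ)) (by simp) hε.le
  have h3 := hC (t + ε * I) (by simpa using hε) ((le_max_left _ _).trans (h1.trans h2))
  have h4 : 1 ≤ |t| := (le_max_right _ _).trans h1
  have h5 : (f (t + ε * I)).im ≤ C * 1 / |t| ^ 2 := by
    refine h3.trans ?_
    gcongr
    simpa using hε1
  have h6 : 0 ≤ 2 * C * (1 + t ^ 2)⁻¹ := by positivity
  rw [div_le_iff₀ Real.pi_pos]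
  have h7 : C * 1 / |t| ^ 2 ≤ 2 * C * (1 + t ^ 2)⁻¹ := by
    rw [sq_abs, ← div_eq_mul_inv, div_le_div_iff₀ (by nlinarith [sq_abs t]) (by positivity)]
    have h8 : 1 ≤ t ^ 2 := by nlinarith [sq_abs t]
    linarith [mul_le_mul_of_nonneg_left h8 hC0]
  nlinarith [Real.pi_gt_three]

include hf in
theorem isFiniteMeasure_boundaryMeasure (hC0 : 0 ≤ C)
    (hC : ∀ z : ℂ, 0 < z.im → B ≤ ‖z‖ → (f z).im ≤ C * z.im / ‖z‖ ^ 2) {ε : ℝ} (hε : 0 < ε)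
    (hε1 : ε ≤ 1) : IsFiniteMeasure (boundaryMeasure f ε) := by
  refine ⟨?_⟩
  rw [← union_compl_self (Icc (-max B 1) (max B 1))]
  refine (measure_union_le _ _).trans_lt (ENNReal.add_lt_top.2 ⟨?_, ?_⟩)
  · rw [boundaryMeasure, withDensity_apply _ measurableSet_Icc]
    refine (ContinuousOn.integrableOn_Icc ?_).lintegral_lt_top
    exact ((continuous_im_boundary hf hε).div_const _).continuousOn
  · refine (boundaryMeasure_le_dominatingMeasure hC0 hC hε hε1 measurableSet_Icc.compl ?_).trans_lt
      (measure_lt_top _ _)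
    intro t ht
    rw [mem_compl_iff, mem_Icc, ← abs_le, not_le] at ht
    exact ht.le

include hf in
-- The total mass is the limit of `-i y f(i (y + ε))`; the shift only contributes the factor `y / (y
-- + ε)`, which tends to `1`.
theorem isProbabilityMeasure_boundaryMeasure (him : ∀ z : ℂ, 0 < z.im → 0 ≤ (f z).im)
    (hM : ∀ z : ℂ, 0 < z.im → B ≤ ‖z‖ → ‖f z‖ ≤ M / ‖z‖) (hC0 : 0 ≤ C)
    (hC : ∀ z : ℂ, 0 < z.im → B ≤ ‖z‖ → (f z).im ≤ C * z.im / ‖z‖ ^ 2)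
    (hlim : Tendsto (fun y : ℝ => -(y * I) * f (y * I)) atTop (𝓝 1)) {ε : ℝ} (hε : 0 < ε)
    (hε1 : ε ≤ 1) : IsProbabilityMeasure (boundaryMeasure f ε) := by
  have := isFiniteMeasure_boundaryMeasure hf hC0 hC hε hε1
  have h1 := tendsto_neg_mul_resolventTransform_atTop (boundaryMeasure f ε)
  have h2 : Tendsto (fun y : ℝ => -(y * I) * resolventTransform (boundaryMeasure f ε) (y * I : ℂ))
      atTop (𝓝 1) := by
    have h3 := hlim.comp (tendsto_atTop_add_const_right atTop ε tendsto_id)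
    have h4 : Tendsto (fun y : ℝ => (1 + ε * ((y⁻¹ : ℝ) : ℂ))⁻¹) atTop (𝓝 1) := by
      have : Tendsto (fun y : ℝ => 1 + ε * ((y⁻¹ : ℝ) : ℂ)) atTop (𝓝 (1 + ε * ((0 : ℝ) : ℂ))) :=
        ((Complex.continuous_ofReal.tendsto _).comp tendsto_inv_atTop_zero).const_mul _ |>.const_add _
      simpa using this.inv₀ (by simp)
    have h5 := h3.mul h4
    rw [mul_one] at h5
    refine h5.congr' ?_
    filter_upwards [eventually_gt_atTop 0] with y hy
    rw [resolventTransform_boundaryMeasure hf him hM hε (by simpa using hy)]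
    have hy' : (y : ℂ) ≠ 0 := by exact_mod_cast hy.ne'
    have hy2 : (y : ℂ) + ε ≠ 0 := by exact_mod_cast (by positivity : y + ε ≠ 0)
    have h6 : (1 + ε * ((y⁻¹ : ℝ) : ℂ))⁻¹ = y / (y + ε) := by
      push_cast
      field_simp
    simp only [Function.comp_apply, id_eq, ofReal_add]
    rw [h6, ← add_mul]
    field_simp
  have h3 := tendsto_nhds_unique h1 h2
  refine ⟨?_⟩
  have h4 : (boundaryMeasure f ε).real univ = 1 := by exact_mod_cast h3
  rw [measureReal_def] at h4
  exact (ENNReal.toReal_eq_one_iff _).1 h4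

include hf in
/-- A holomorphic function that maps the upper half plane to its closure and behaves near infinity like
the Stieltjes transform of a compactly supported probability measure is the Stieltjes transform of
a probability measure. -/
theorem exists_isStieltjesTransform (him : ∀ z : ℂ, 0 < z.im → 0 ≤ (f z).im)
    (hM : ∀ z : ℂ, 0 < z.im → B ≤ ‖z‖ → ‖f z‖ ≤ M / ‖z‖) (hC0 : 0 ≤ C)
    (hC : ∀ z : ℂ, 0 < z.im → B ≤ ‖z‖ → (f z).im ≤ C * z.im / ‖z‖ ^ 2)
    (hlim : Tendsto (fun y : ℝ => -(y * I) * f (y * I)) atTop (𝓝 1)) :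
    ∃ μ : Measure ℝ, IsProbabilityMeasure μ ∧ IsStieltjesTransform f μ := by
  have hε : ∀ n : ℕ, 0 < ((n : ℝ) + 1)⁻¹ := fun n => by positivity
  have hε1 : ∀ n : ℕ, ((n : ℝ) + 1)⁻¹ ≤ 1 := fun n => inv_le_one_of_one_le₀ (by linarith [n.cast_nonneg (α := ℝ)])
  let μs : ℕ → ProbabilityMeasure ℝ := fun n =>
    ⟨boundaryMeasure f ((n : ℝ) + 1)⁻¹,
      isProbabilityMeasure_boundaryMeasure hf him hM hC0 hC hlim (hε n) (hε1 n)⟩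
  -- These compact sets exhaust the line, and all of them contain the interval outside which the
  -- domination holds. Their complements have uniformly small mass, as Prokhorov's theorem requires.
  let K : ℕ → Set ℝ := fun n => Icc (-((n : ℝ) + max B 1)) (n + max B 1)
  have hKmono : Monotone K := fun m n hmn => by
    have : (m : ℝ) ≤ n := by exact_mod_cast hmn
    exact Icc_subset_Icc (by linarith) (by linarith)
  let u : ℕ → ℝ≥0 := fun n => (dominatingMeasure (2 * C) (K n)ᶜ).toNNReal
  have hu : Tendsto u atTop (𝓝 0) := by
    have h1 := tendsto_measure_iInter_atTop (μ := dominatingMeasure (2 * C)) (s := fun n => (K n)ᶜ)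
      (fun n => measurableSet_Icc.compl.nullMeasurableSet) (fun m n hmn => compl_subset_compl.2 (hKmono hmn))
      ⟨0, measure_ne_top _ _⟩
    have h2 : ⋂ n, (K n)ᶜ = ∅ := by
      refine eq_empty_of_forall_notMem fun x hx => ?_
      obtain ⟨n, hn⟩ := exists_nat_gt |x|
      refine mem_iInter.1 hx n ?_
      have : (0 : ℝ) < max B 1 := one_pos.trans_le (le_max_right _ _)
      exact abs_le.1 (by linarith : |x| ≤ n + max B 1)
    rw [h2, measure_empty] at h1
    exact (ENNReal.tendsto_toNNReal ENNReal.zero_ne_top).comp h1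
  have hmem : ∀ n, μs n ∈ {μ : ProbabilityMeasure ℝ | ∀ n, μ (K n)ᶜ ≤ u n} := fun n m => by
    refine ENNReal.toNNReal_mono (measure_ne_top _ _) ?_
    refine boundaryMeasure_le_dominatingMeasure hC0 hC (hε n) (hε1 n) measurableSet_Icc.compl ?_
    intro t ht
    rw [mem_compl_iff, mem_Icc, ← abs_le, not_le] at ht
    have : (0 : ℝ) ≤ m := m.cast_nonneg
    linarith
  have hcomp := isCompact_setOfPred_probabilityMeasure_mass_eq_compl_isCompact_le (E := ℝ) hu
    (fun n => isCompact_Icc) (Or.inr hKmono)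
  -- A limit along a nonprincipal ultrafilter replaces the choice of a subsequence. It suffices
  -- because the transforms themselves converge to `f`.
  obtain ⟨μ, -, hμ⟩ := hcomp.ultrafilter_le_nhds ((hyperfilter ℕ).map μs)
    (le_principal_iff.2 (mem_map.2 (univ_mem' hmem)))
  have hμ' : Tendsto μs (hyperfilter ℕ) (𝓝 μ) := hμ
  refine ⟨μ, inferInstance, fun z hz => ?_⟩
  rw [ProbabilityMeasure.tendsto_iff_forall_integral_rclike_tendsto ℂ] at hμ'
  have h1 := hμ' (BoundedContinuousFunction.ofNormedAddCommGroup _ (continuous_inv_ofReal_sub hz) _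
    (norm_inv_ofReal_sub_le hz))
  simp only [BoundedContinuousFunction.coe_ofNormedAddCommGroup,
    ← resolventTransform_eq_integral_inv] at h1
  have h2 : Tendsto (fun n : ℕ => f (z + ((((n : ℝ) + 1)⁻¹ : ℝ) : ℂ) * I)) atTop (𝓝 (f z)) := by
    have h3 : ContinuousAt f z :=
      hf.continuousOn.continuousAt ((isOpen_lt continuous_const Complex.continuous_im).mem_nhds hz)
    have h4 : Tendsto (fun n : ℕ => z + ((((n : ℝ) + 1)⁻¹ : ℝ) : ℂ) * I) atTop (𝓝 (z + ((0 : ℝ) : ℂ) * I)) := by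
      refine (((Complex.continuous_ofReal.tendsto _).comp ?_).mul_const _).const_add _
      simpa [one_div] using tendsto_one_div_add_atTop_nhds_zero_nat (𝕜 := ℝ)
    rw [ofReal_zero, zero_mul, add_zero] at h4
    exact h3.tendsto.comp h4
  refine tendsto_nhds_unique (h2.mono_left Nat.hyperfilter_le_atTop) (h1.congr fun n => ?_)
  exact resolventTransform_boundaryMeasure hf him hM (hε n) hz

end

end SampleCovariance

/-! ### Quadratic forms, traces of inverses and operator norms. -/

namespace SampleCovariance

open Filter Topology Complex Set
open scoped ComplexConjugate Matrix

section QuadraticForm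

variable {p : ℕ}

theorem star_dotProduct_self_eq (v : Fin p → ℂ) : star v ⬝ᵥ v = ((∑ k, ‖v k‖ ^ 2 : ℝ) : ℂ) := by
  simp only [dotProduct, Pi.star_apply, RCLike.star_def, Complex.conj_mul', ofReal_sum, ofReal_pow]

theorem sum_norm_sq_pos {v : Fin p → ℂ} (hv : v ≠ 0) : 0 < ∑ k, ‖v k‖ ^ 2 := by
  obtain ⟨k, hk⟩ := Function.ne_iff.1 hv
  exact Finset.sum_pos' (fun _ _ => by positivity) ⟨k, Finset.mem_univ k, by
    have : v k ≠ 0 := hk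
    positivity⟩

theorem star_dotProduct_conjTranspose_mul_self_mulVec (N : Matrix (Fin p) (Fin p) ℂ) (v : Fin p → ℂ) :
    star v ⬝ᵥ (Nᴴ * N) *ᵥ v = ((∑ k, ‖(N *ᵥ v) k‖ ^ 2 : ℝ) : ℂ) := by
  rw [← star_dotProduct_self_eq, ← Matrix.mulVec_mulVec, Matrix.dotProduct_mulVec,
    Matrix.vecMul_conjTranspose, star_star]

theorem det_ne_zero_of_star_dotProduct_ne_zero {M : Matrix (Fin p) (Fin p) ℂ}
    (h : ∀ v, v ≠ 0 → star v ⬝ᵥ M *ᵥ v ≠ 0) : M.det ≠ 0 := fun h0 => by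
  obtain ⟨v, hv, hMv⟩ := Matrix.exists_mulVec_eq_zero_iff.2 h0
  exact h v hv (by rw [hMv, dotProduct_zero])

/-- The trace of `Nᴴ N M⁻¹` is a sum of conjugated values of the quadratic form of `M`. -/
theorem trace_conjTranspose_mul_self_mul_inv {M : Matrix (Fin p) (Fin p) ℂ} (hM : M.det ≠ 0)
    (N : Matrix (Fin p) (Fin p) ℂ) :
    (Nᴴ * N * M⁻¹).trace = ∑ a, conj (star (M⁻¹ *ᵥ (Nᴴ).col a) ⬝ᵥ M *ᵥ (M⁻¹ *ᵥ (Nᴴ).col a)) := by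
  have h1 : Nᴴ * N * M⁻¹ = Nᴴ * (N * M⁻¹) := Matrix.mul_assoc _ _ _
  rw [h1, Matrix.trace_mul_comm, Matrix.trace]
  refine Finset.sum_congr rfl fun a _ => ?_
  -- With `u = M⁻¹ Nᴴ e_a`, so that `M u = Nᴴ e_a`, the diagonal entry of `N M⁻¹ Nᴴ` is `star (M u)
  -- ⬝ᵥ u`, the conjugate of `star u ⬝ᵥ M u`.
  rw [Matrix.mulVec_mulVec, Matrix.mul_nonsing_inv _ (isUnit_iff_ne_zero.2 hM), Matrix.one_mulVec,
    starRingEnd_apply, ← Matrix.star_dotProduct, Matrix.diag_apply, Matrix.mul_assoc, Matrix.mul_apply]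
  simp [dotProduct, Matrix.mulVec, Matrix.mul_apply]

theorem im_trace_conjTranspose_mul_self_mul_inv_nonpos {M : Matrix (Fin p) (Fin p) ℂ}
    (hM : M.det ≠ 0) (h : ∀ v, 0 ≤ (star v ⬝ᵥ M *ᵥ v).im) (N : Matrix (Fin p) (Fin p) ℂ) :
    (Nᴴ * N * M⁻¹).trace.im ≤ 0 := by
  rw [trace_conjTranspose_mul_self_mul_inv hM, Complex.im_sum]
  exact Finset.sum_nonpos fun a _ => by
    rw [Complex.conj_im]
    exact neg_nonpos.2 (h _)

theorem re_trace_inv_nonneg {M : Matrix (Fin p) (Fin p) ℂ}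
    (hM : M.det ≠ 0) (h : ∀ v, 0 ≤ (star v ⬝ᵥ M *ᵥ v).re) :
    0 ≤ (M⁻¹).trace.re := by
  have h1 := trace_conjTranspose_mul_self_mul_inv hM 1
  rw [Matrix.conjTranspose_one, Matrix.one_mul, Matrix.one_mul] at h1
  rw [h1, Complex.re_sum]
  exact Finset.sum_nonneg fun a _ => by
    rw [Complex.conj_re]
    exact h _

theorem norm_star_dotProduct_sq_le (u v : Fin p → ℂ) :
    ‖star u ⬝ᵥ v‖ ^ 2 ≤ (∑ k, ‖u k‖ ^ 2) * ∑ k, ‖v k‖ ^ 2 := by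
  refine le_trans ?_ (Finset.sum_mul_sq_le_sq_mul_sq _ _ _)
  gcongr
  exact norm_sum_le_of_le _ fun k _ => by simp

/-- Cauchy-Schwarz gives `y |v|² ≤ |v| |u|`, and one factor `|v|` cancels. -/
theorem mul_le_of_le_im_star_dotProduct {v u : Fin p → ℂ} {y : ℝ} (hy : 0 < y)
    (h : y * ∑ k, ‖v k‖ ^ 2 ≤ (star v ⬝ᵥ u).im) :
    ∑ k, ‖v k‖ ^ 2 ≤ (1 / y) ^ 2 * ∑ k, ‖u k‖ ^ 2 := by
  have h2 := norm_star_dotProduct_sq_le v u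
  have h3 := Complex.abs_im_le_norm (star v ⬝ᵥ u)
  have hs : 0 ≤ ∑ k, ‖v k‖ ^ 2 := by positivity
  have hr : 0 ≤ ∑ k, ‖u k‖ ^ 2 := by positivity
  generalize ∑ k, ‖v k‖ ^ 2 = s at *
  generalize ∑ k, ‖u k‖ ^ 2 = r at *
  have h4 : (y * s) ^ 2 ≤ s * r := by
    refine le_trans ?_ h2
    have : 0 ≤ y * s := by positivity
    gcongr
    exact h.trans ((le_abs_self _).trans h3)
  rw [div_pow, one_pow, div_mul_eq_mul_div, one_mul, le_div_iff₀ (by positivity)]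
  rcases hs.eq_or_lt with h5 | h5
  · rw [← h5]; simpa using hr
  · have : s * (s * y ^ 2) ≤ s * r := by linarith [h4, mul_pow y s 2]
    exact le_of_mul_le_mul_left this h5

theorem det_ne_zero_of_le_im {M : Matrix (Fin p) (Fin p) ℂ} {y : ℝ} (hy : 0 < y)
    (h : ∀ v : Fin p → ℂ, y * ∑ k, ‖v k‖ ^ 2 ≤ (star v ⬝ᵥ M *ᵥ v).im) : M.det ≠ 0 :=
  det_ne_zero_of_star_dotProduct_ne_zero fun v hv h0 => by
    have h1 := h v
    rw [h0, Complex.zero_im] at h1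
    have := mul_pos hy (sum_norm_sq_pos hv)
    linarith

open scoped Matrix.Norms.L2Operator

theorem norm_entry_le_l2_opNorm (M : Matrix (Fin p) (Fin p) ℂ) (k l : Fin p) : ‖M k l‖ ≤ ‖M‖ := by
  have h1 := M.l2_opNorm_mulVec (EuclideanSpace.single l 1)
  have h2 := PiLp.norm_apply_le (WithLp.toLp 2 (M *ᵥ (EuclideanSpace.single l (1 : ℂ)).ofLp)) k
  simpa using h2.trans h1

theorem norm_trace_le (M : Matrix (Fin p) (Fin p) ℂ) : ‖M.trace‖ ≤ p * ‖M‖ := by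
  rw [Matrix.trace]
  refine (norm_sum_le_of_le _ fun k _ => norm_entry_le_l2_opNorm M k k).trans_eq ?_
  simp

theorem l2_opNorm_le_of_forall {M : Matrix (Fin p) (Fin p) ℂ} {c : ℝ} (hc : 0 ≤ c)
    (h : ∀ v : Fin p → ℂ, ∑ k, ‖(M *ᵥ v) k‖ ^ 2 ≤ c ^ 2 * ∑ k, ‖v k‖ ^ 2) : ‖M‖ ≤ c := by
  rw [Matrix.l2_opNorm_def]
  refine ContinuousLinearMap.opNorm_le_bound _ hc fun v => ?_
  have h1 := h v.ofLp
  rw [EuclideanSpace.norm_eq, EuclideanSpace.norm_eq, ← Real.sqrt_sq hc, ← Real.sqrt_mul (by positivity)]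
  exact Real.sqrt_le_sqrt h1

/-- Coercivity of the imaginary part of the form is used at `v = M⁻¹ u`, where it compares `M⁻¹ u`
with `u`. -/
theorem l2_opNorm_inv_le {M : Matrix (Fin p) (Fin p) ℂ} {y : ℝ} (hy : 0 < y)
    (h : ∀ v : Fin p → ℂ, y * ∑ k, ‖v k‖ ^ 2 ≤ (star v ⬝ᵥ M *ᵥ v).im) : ‖M⁻¹‖ ≤ 1 / y := by
  refine l2_opNorm_le_of_forall (by positivity) fun u => mul_le_of_le_im_star_dotProduct hy ?_
  have h1 := h (M⁻¹ *ᵥ u)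
  rwa [Matrix.mulVec_mulVec, Matrix.mul_nonsing_inv _ (isUnit_iff_ne_zero.2 (det_ne_zero_of_le_im hy h)),
    Matrix.one_mulVec] at h1

end QuadraticForm

end SampleCovariance

/-! ### The fixed point map: resolvent identity, weighted contraction and uniqueness. -/

namespace SampleCovariance

open Filter Topology Complex Set
open scoped ComplexConjugate Matrix

section FixedPointMap

variable {n p : ℕ} {S : Fin n → Matrix (Fin p) (Fin p) ℝ}

/-- The matrix `I_p - (1/n) ∑ i, Σ_i / L_i`. -/
noncomputable def tildeA (S : Fin n → Matrix (Fin p) (Fin p) ℝ) (L : Fin n → ℂ) :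
    Matrix (Fin p) (Fin p) ℂ :=
  1 - (1 / (n : ℂ)) • ∑ i, (1 / L i) • (S i).map Complex.ofReal

/-- The fixed point map `L ↦ z - (1/n) tr (Σ_i (I_p - (1/n) ∑ j, Σ_j / L_j)⁻¹)`. -/
noncomputable def fixedPointMap (S : Fin n → Matrix (Fin p) (Fin p) ℝ) (z : ℂ) (L : Fin n → ℂ) :
    Fin n → ℂ :=
  fun i => z - (1 / (n : ℂ)) * ((S i).map Complex.ofReal * tildeQ S L).trace

theorem tildeQ_eq_inv (S : Fin n → Matrix (Fin p) (Fin p) ℝ) (L : Fin n → ℂ) :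
    tildeQ S L = (tildeA S L)⁻¹ := rfl

theorem isSolution_iff {z : ℂ} {L : Fin n → ℂ} :
    IsSolution S z L ↔ (∀ i, 0 < (L i).im) ∧ fixedPointMap S z L = L :=
  and_congr_right fun _ => by
    rw [funext_iff]
    exact forall_congr' fun i => eq_comm

theorem exists_map_eq_conjTranspose_mul_self {T : Matrix (Fin p) (Fin p) ℝ} (hT : T.PosSemidef) :
    ∃ N : Matrix (Fin p) (Fin p) ℝ, T.map Complex.ofReal =
      (N.map Complex.ofReal)ᴴ * N.map Complex.ofReal := by
  classical
  open scoped MatrixOrder in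
  obtain ⟨N, hN⟩ := CStarAlgebra.nonneg_iff_eq_star_mul_self.1 (Matrix.nonneg_iff_posSemidef.2 hT)
  refine ⟨N, ?_⟩
  ext a b
  rw [hN]
  simp [Matrix.mul_apply]

theorem conjTranspose_map_ofReal (N : Matrix (Fin p) (Fin p) ℝ) :
    (N.map Complex.ofReal)ᴴ = (N.map Complex.ofReal)ᵀ := by
  ext a b; simp

theorem transpose_map_eq_self {T : Matrix (Fin p) (Fin p) ℝ} (hT : T.PosSemidef) :
    (T.map Complex.ofReal)ᵀ = T.map Complex.ofReal := by
  rw [← conjTranspose_map_ofReal]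
  ext a b
  simpa using congrFun (congrFun hT.1 a) b

/-- The quadratic form of a positive semidefinite matrix at a complex vector. -/
noncomputable def quadForm (T : Matrix (Fin p) (Fin p) ℝ) (v : Fin p → ℂ) : ℝ :=
  (star v ⬝ᵥ (T.map Complex.ofReal) *ᵥ v).re

theorem star_dotProduct_map_mulVec {T : Matrix (Fin p) (Fin p) ℝ} (hT : T.PosSemidef)
    (v : Fin p → ℂ) : star v ⬝ᵥ (T.map Complex.ofReal) *ᵥ v = quadForm T v := by
  obtain ⟨N, hN⟩ := exists_map_eq_conjTranspose_mul_self hT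
  rw [quadForm, hN, star_dotProduct_conjTranspose_mul_self_mulVec, ofReal_re]

theorem quadForm_nonneg {T : Matrix (Fin p) (Fin p) ℝ} (hT : T.PosSemidef) (v : Fin p → ℂ) :
    0 ≤ quadForm T v := by
  obtain ⟨N, hN⟩ := exists_map_eq_conjTranspose_mul_self hT
  rw [quadForm, hN, star_dotProduct_conjTranspose_mul_self_mulVec, ofReal_re]
  positivity

/-- The scalar `c` serves two cases: `c = 1`, where positivity comes from `-1 / L_i`, and `c = z`,
where `z.im` makes the form coercive. -/
theorem star_dotProduct_smul_tildeA_mulVec (hS : ∀ i, (S i).PosSemidef) (c : ℂ) (L : Fin n → ℂ)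
    (v : Fin p → ℂ) :
    star v ⬝ᵥ (c • tildeA S L) *ᵥ v =
      c * ((∑ k, ‖v k‖ ^ 2 : ℝ) : ℂ) + ∑ i, ((quadForm (S i) v / n : ℝ) : ℂ) * (-(c / L i)) := by
  simp only [tildeA, Matrix.smul_mulVec, Matrix.sub_mulVec, Matrix.one_mulVec, Matrix.sum_mulVec,
    dotProduct_smul, dotProduct_sub, dotProduct_sum, star_dotProduct_map_mulVec (hS _),
    star_dotProduct_self_eq, smul_eq_mul]
  rw [mul_sub, sub_eq_add_neg, Finset.mul_sum, Finset.mul_sum, ← Finset.sum_neg_distrib]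
  congr 1
  refine Finset.sum_congr rfl fun i _ => ?_
  push_cast
  ring

theorem im_star_dotProduct_smul_tildeA_mulVec (hS : ∀ i, (S i).PosSemidef) {c : ℂ} {L : Fin n → ℂ}
    (hL : ∀ i, 0 ≤ (-(c / L i)).im) (v : Fin p → ℂ) :
    c.im * ∑ k, ‖v k‖ ^ 2 ≤ (star v ⬝ᵥ (c • tildeA S L) *ᵥ v).im := by
  rw [star_dotProduct_smul_tildeA_mulVec hS, Complex.add_im, Complex.im_mul_ofReal, Complex.im_sum]
  refine le_add_of_nonneg_right (Finset.sum_nonneg fun i _ => ?_)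
  rw [Complex.im_ofReal_mul]
  exact mul_nonneg (div_nonneg (quadForm_nonneg (hS i) v) n.cast_nonneg) (hL i)

theorem im_neg_one_div (w : ℂ) : (-(1 / w)).im = w.im / ‖w‖ ^ 2 := by
  rw [one_div, neg_im, Complex.inv_im, Complex.normSq_eq_norm_sq]
  ring

/-- Each `-1 / L_i` has positive imaginary part. If the form of `A` vanished at `v`, its imaginary
part would force every weight `quadForm (S i) v / n` to vanish, leaving only `|v|²`, which is
nonzero. -/
theorem det_tildeA_ne_zero (hS : ∀ i, (S i).PosSemidef) {L : Fin n → ℂ} (hL : ∀ i, 0 < (L i).im) :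
    (tildeA S L).det ≠ 0 := by
  refine det_ne_zero_of_star_dotProduct_ne_zero fun v hv h0 => ?_
  have h1 := star_dotProduct_smul_tildeA_mulVec hS 1 L v
  rw [one_smul, h0, one_mul] at h1
  have hpos : ∀ i, 0 < (-(1 / L i)).im := fun i => by
    rw [im_neg_one_div]
    have : L i ≠ 0 := fun h => by simpa [h] using hL i
    exact div_pos (hL i) (by positivity)
  have him := congrArg Complex.im h1
  simp only [zero_im, add_im, ofReal_im, im_sum, zero_add, Complex.im_ofReal_mul] at him
  have hz := (Finset.sum_eq_zero_iff_of_nonneg fun i _ =>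
    mul_nonneg (div_nonneg (quadForm_nonneg (hS i) v) n.cast_nonneg) (hpos i).le).1 him.symm
  have hz' : ∑ i, ((quadForm (S i) v / n : ℝ) : ℂ) * (-(1 / L i)) = 0 :=
    Finset.sum_eq_zero fun i hi => by
      rcases mul_eq_zero.1 (hz i hi) with h | h
      · rw [h]; simp
      · exact absurd h (hpos i).ne'
  rw [hz', add_zero] at h1
  have h2 := sum_norm_sq_pos hv
  exact h2.ne (by exact_mod_cast h1)

theorem transpose_tildeA (hS : ∀ i, (S i).PosSemidef) (L : Fin n → ℂ) :
    (tildeA S L)ᵀ = tildeA S L := by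
  simp only [tildeA, Matrix.transpose_sub, Matrix.transpose_one, Matrix.transpose_smul,
    Matrix.transpose_sum, transpose_map_eq_self (hS _)]

theorem transpose_tildeQ (hS : ∀ i, (S i).PosSemidef) (L : Fin n → ℂ) :
    (tildeQ S L)ᵀ = tildeQ S L := by
  rw [tildeQ_eq_inv, Matrix.transpose_nonsing_inv, transpose_tildeA hS]

theorem conjTranspose_tildeA (hS : ∀ i, (S i).PosSemidef) (L : Fin n → ℂ) :
    (tildeA S L)ᴴ = tildeA S (fun i => conj (L i)) := by
  simp only [tildeA, Matrix.conjTranspose_sub, Matrix.conjTranspose_one, Matrix.conjTranspose_smul,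
    Matrix.conjTranspose_sum, conjTranspose_map_ofReal, transpose_map_eq_self (hS _)]
  simp

/-- The matrix `A` is symmetric though not Hermitian, so conjugating `L` gives its adjoint, and the
adjoint of the symmetric inverse is its entrywise conjugate. -/
theorem tildeQ_conj (hS : ∀ i, (S i).PosSemidef) (L : Fin n → ℂ) :
    tildeQ S (fun i => conj (L i)) = (tildeQ S L).map conj := by
  rw [tildeQ_eq_inv, ← conjTranspose_tildeA hS, ← Matrix.conjTranspose_nonsing_inv, ← tildeQ_eq_inv,
    Matrix.conjTranspose, transpose_tildeQ hS]
  rfl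

/-- The resolvent identity `Q - Q' = Q (A' - A) Q'`, in which `A' - A` is linear in the `Σ_j`. -/
theorem trace_mul_tildeQ_sub {L L' : Fin n → ℂ}
    (hL : ∀ i, L i ≠ 0) (hL' : ∀ i, L' i ≠ 0) (hA : (tildeA S L).det ≠ 0)
    (hA' : (tildeA S L').det ≠ 0) (T : Matrix (Fin p) (Fin p) ℂ) :
    (T * tildeQ S L).trace - (T * tildeQ S L').trace =
      -∑ j, (1 / (n : ℂ)) * ((L j - L' j) / (L j * L' j))
        * (T * tildeQ S L * (S j).map Complex.ofReal * tildeQ S L').trace := by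
  have h1 : tildeQ S L - tildeQ S L' = tildeQ S L * (tildeA S L' - tildeA S L) * tildeQ S L' := by
    rw [Matrix.mul_sub, Matrix.sub_mul, tildeQ_eq_inv, tildeQ_eq_inv,
      Matrix.nonsing_inv_mul _ (isUnit_iff_ne_zero.2 hA), Matrix.one_mul, Matrix.mul_assoc,
      Matrix.mul_nonsing_inv _ (isUnit_iff_ne_zero.2 hA'), Matrix.mul_one]
  have h2 : tildeA S L' - tildeA S L =
      -∑ j, ((1 / (n : ℂ)) * ((L j - L' j) / (L j * L' j))) • (S j).map Complex.ofReal := by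
    rw [tildeA, tildeA, sub_sub_sub_cancel_left, ← smul_sub, ← Finset.sum_sub_distrib,
      Finset.smul_sum, ← Finset.sum_neg_distrib]
    refine Finset.sum_congr rfl fun j _ => ?_
    rw [← sub_smul, smul_smul, ← neg_smul]
    congr 1
    have := hL j
    have := hL' j
    field_simp
    ring
  rw [← Matrix.trace_sub, ← Matrix.mul_sub, h1, h2]
  simp only [Matrix.mul_neg, Matrix.neg_mul, Matrix.trace_neg, Matrix.mul_sum, Matrix.sum_mul,
    Matrix.trace_sum, Matrix.mul_smul, Matrix.smul_mul, Matrix.trace_smul, smul_eq_mul, Matrix.mul_assoc]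

/-- Transposes rather than adjoints keep the expression bilinear in `Q` and `Q'`. Conjugate
arguments then produce squared moduli, and general ones an inner product open to Cauchy-Schwarz. -/
theorem trace_mul_mul_mul_eq_sum {N N' Q Q' : Matrix (Fin p) (Fin p) ℂ} (hQ' : Q'ᵀ = Q') :
    (Nᵀ * N * Q * (N'ᵀ * N') * Q').trace =
      ∑ x : Fin p × Fin p, (N * Q * N'ᵀ) x.1 x.2 * (N * Q' * N'ᵀ) x.1 x.2 := by
  have h : Nᵀ * N * Q * (N'ᵀ * N') * Q' = Nᵀ * (N * Q * N'ᵀ * N' * Q') := by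
    simp only [Matrix.mul_assoc]
  have h2 : N * Q * N'ᵀ * N' * Q' * Nᵀ = (N * Q * N'ᵀ) * (N * Q' * N'ᵀ)ᵀ := by
    simp only [Matrix.transpose_mul, Matrix.transpose_transpose, hQ', Matrix.mul_assoc]
  rw [h, Matrix.trace_mul_comm, h2, Matrix.trace, Fintype.sum_prod_type]
  generalize N * Q * N'ᵀ = X
  generalize N * Q' * N'ᵀ = Y
  simp [Matrix.mul_apply]

theorem exists_map_eq_transpose_mul_self (hS : ∀ i, (S i).PosSemidef) :
    ∃ N : Fin n → Matrix (Fin p) (Fin p) ℝ, ∀ i, (S i).map Complex.ofReal =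
      ((N i).map Complex.ofReal)ᵀ * (N i).map Complex.ofReal := by
  choose N hN using fun i => exists_map_eq_conjTranspose_mul_self (hS i)
  exact ⟨N, fun i => by rw [hN, conjTranspose_map_ofReal]⟩

/-- The matrix `N_i Q N_jᵀ`, where `Q` is the resolvent at `L`. -/
noncomputable def interaction (S N : Fin n → Matrix (Fin p) (Fin p) ℝ) (L : Fin n → ℂ) (i j : Fin n) :
    Matrix (Fin p) (Fin p) ℂ :=
  (N i).map Complex.ofReal * tildeQ S L * ((N j).map Complex.ofReal)ᵀ

theorem interaction_conj (hS : ∀ i, (S i).PosSemidef) (N : Fin n → Matrix (Fin p) (Fin p) ℝ)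
    (L : Fin n → ℂ) (i j : Fin n) :
    interaction S N (fun i => conj (L i)) i j = (interaction S N L i j).map conj := by
  rw [interaction, interaction, tildeQ_conj hS, Matrix.map_mul, Matrix.map_mul]
  congr 2
  · ext a b; simp
  · ext a b; simp

theorem fixedPointMap_sub (hS : ∀ i, (S i).PosSemidef) {N : Fin n → Matrix (Fin p) (Fin p) ℝ}
    (hN : ∀ i, (S i).map Complex.ofReal = ((N i).map Complex.ofReal)ᵀ * (N i).map Complex.ofReal)
    {L L' : Fin n → ℂ} (hL : ∀ i, L i ≠ 0) (hL' : ∀ i, L' i ≠ 0) (hA : (tildeA S L).det ≠ 0)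
    (hA' : (tildeA S L').det ≠ 0) (z : ℂ) (i : Fin n) :
    fixedPointMap S z L i - fixedPointMap S z L' i =
      ∑ x : Fin n × Fin p × Fin p, (1 / (n : ℂ)) ^ 2 * ((L x.1 - L' x.1) / (L x.1 * L' x.1)) *
        (interaction S N L i x.1 x.2.1 x.2.2 * interaction S N L' i x.1 x.2.1 x.2.2) := by
  have h := trace_mul_tildeQ_sub hL hL' hA hA' ((S i).map Complex.ofReal)
  rw [fixedPointMap, fixedPointMap, sub_sub_sub_cancel_left, ← mul_sub, ← neg_sub, h, neg_neg,
    Finset.mul_sum, Fintype.sum_prod_type]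
  refine Finset.sum_congr rfl fun j _ => ?_
  rw [hN i, hN j, trace_mul_mul_mul_eq_sum (transpose_tildeQ hS L'), Finset.mul_sum, Finset.mul_sum]
  refine Finset.sum_congr rfl fun x _ => ?_
  rw [interaction, interaction]
  ring

/-- This is the difference formula at `L` and `conj L`: the products of entries become squared
moduli, and `(L - conj L) / (L conj L)` is `2 i Im L / |L|²`. -/
theorem im_fixedPointMap (hS : ∀ i, (S i).PosSemidef) {N : Fin n → Matrix (Fin p) (Fin p) ℝ}
    (hN : ∀ i, (S i).map Complex.ofReal = ((N i).map Complex.ofReal)ᵀ * (N i).map Complex.ofReal)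
    {L : Fin n → ℂ} (hL : ∀ i, 0 < (L i).im) (z : ℂ) (i : Fin n) :
    (fixedPointMap S z L i).im - z.im = ∑ x : Fin n × Fin p × Fin p,
      (1 / (n : ℝ)) ^ 2 * ((L x.1).im / ‖L x.1‖ ^ 2) * ‖interaction S N L i x.1 x.2.1 x.2.2‖ ^ 2 := by
  have hL0 : ∀ i, L i ≠ 0 := fun i h => by simpa [h] using hL i
  have hA := det_tildeA_ne_zero hS hL
  have hA' : (tildeA S fun i => conj (L i)).det ≠ 0 := by
    rw [← conjTranspose_tildeA hS, Matrix.det_conjTranspose]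
    exact star_ne_zero.2 hA
  have h := fixedPointMap_sub hS hN hL0 (fun i => by simpa using hL0 i) hA hA' z i
  have h1 : fixedPointMap S z L i - fixedPointMap S z (fun i => conj (L i)) i =
      2 * I * (((fixedPointMap S z L i).im - z.im : ℝ) : ℂ) := by
    have h2 : ((S i).map Complex.ofReal * tildeQ S fun i => conj (L i)).trace
        = conj ((S i).map Complex.ofReal * tildeQ S L).trace := by
      rw [tildeQ_conj hS]
      simp [Matrix.trace, Matrix.mul_apply]
    rw [fixedPointMap, fixedPointMap, h2, sub_sub_sub_cancel_left, ← mul_sub, ← neg_sub,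
      Complex.sub_conj]
    have h3 : (z - 1 / (n : ℂ) * ((S i).map Complex.ofReal * tildeQ S L).trace).im - z.im
        = -((1 / (n : ℝ)) * ((S i).map Complex.ofReal * tildeQ S L).trace.im) := by
      have : (1 / (n : ℂ)) = ((1 / (n : ℝ) : ℝ) : ℂ) := by push_cast; rfl
      rw [Complex.sub_im, this, Complex.im_ofReal_mul]
      ring
    rw [h3]
    push_cast
    ring
  rw [h1] at h
  have h2I : (2 * I : ℂ) ≠ 0 := mul_ne_zero two_ne_zero I_ne_zero
  have hsum : (((fixedPointMap S z L i).im - z.im : ℝ) : ℂ) = ((∑ x : Fin n × Fin p × Fin p,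
      (1 / (n : ℝ)) ^ 2 * ((L x.1).im / ‖L x.1‖ ^ 2) * ‖interaction S N L i x.1 x.2.1 x.2.2‖ ^ 2 : ℝ) : ℂ) := by
    refine mul_left_cancel₀ h2I (h.trans ?_)
    rw [ofReal_sum, Finset.mul_sum]
    refine Finset.sum_congr rfl fun x _ => ?_
    rw [interaction_conj hS, Matrix.map_apply, Complex.mul_conj', Complex.mul_conj', Complex.sub_conj]
    push_cast
    ring
  exact_mod_cast hsum

theorem im_le_im_fixedPointMap (hS : ∀ i, (S i).PosSemidef) {L : Fin n → ℂ}
    (hL : ∀ i, 0 < (L i).im) (z : ℂ) (i : Fin n) : z.im ≤ (fixedPointMap S z L i).im := by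
  obtain ⟨N, hN⟩ := exists_map_eq_transpose_mul_self hS
  rw [← sub_nonneg, im_fixedPointMap hS hN hL]
  exact Finset.sum_nonneg fun x _ => by have := (hL x.1).le; positivity

/-- The fixed point map does not increase the semi-metric
`max_i |L_i - L'_i| / (Im L_i Im L'_i)^(1/2)`. -/
theorem norm_fixedPointMap_sub_sq_le (hS : ∀ i, (S i).PosSemidef) {L L' : Fin n → ℂ}
    (hL : ∀ i, 0 < (L i).im) (hL' : ∀ i, 0 < (L' i).im) {D : ℝ} (hD : 0 ≤ D)
    (h : ∀ j, ‖L j - L' j‖ ^ 2 ≤ D * ((L j).im * (L' j).im)) (z : ℂ) (i : Fin n) :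
    ‖fixedPointMap S z L i - fixedPointMap S z L' i‖ ^ 2 ≤
      D * (((fixedPointMap S z L i).im - z.im) * ((fixedPointMap S z L' i).im - z.im)) := by
  obtain ⟨N, hN⟩ := exists_map_eq_transpose_mul_self hS
  have hL0 : ∀ i, L i ≠ 0 := fun i h => by simpa [h] using hL i
  have hL0' : ∀ i, L' i ≠ 0 := fun i h => by simpa [h] using hL' i
  -- Each term is split into an `L` factor and an `L'` factor, arranged so that the sum of squares
  -- of either one is the increment of the imaginary part in `im_fixedPointMap`.
  have hle : ‖fixedPointMap S z L i - fixedPointMap S z L' i‖ ≤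
      Real.sqrt D * ∑ x : Fin n × Fin p × Fin p,
        ((1 / (n : ℝ)) * (Real.sqrt (L x.1).im / ‖L x.1‖) * ‖interaction S N L i x.1 x.2.1 x.2.2‖) *
        ((1 / (n : ℝ)) * (Real.sqrt (L' x.1).im / ‖L' x.1‖) * ‖interaction S N L' i x.1 x.2.1 x.2.2‖) := by
    rw [fixedPointMap_sub hS hN hL0 hL0' (det_tildeA_ne_zero hS hL) (det_tildeA_ne_zero hS hL'),
      Finset.mul_sum]
    refine norm_sum_le_of_le _ fun x _ => ?_
    have h1 : ‖L x.1 - L' x.1‖ ≤ Real.sqrt D * (Real.sqrt (L x.1).im * Real.sqrt (L' x.1).im) := by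
      rw [← Real.sqrt_mul (hL x.1).le, ← Real.sqrt_mul hD]
      exact Real.le_sqrt_of_sq_le (h x.1)
    simp only [norm_mul, norm_pow, norm_div, norm_one, Complex.norm_natCast]
    calc _ ≤ (1 / (n : ℝ)) ^ 2 * ((Real.sqrt D * (Real.sqrt (L x.1).im * Real.sqrt (L' x.1).im)) /
          (‖L x.1‖ * ‖L' x.1‖)) * (‖interaction S N L i x.1 x.2.1 x.2.2‖ *
          ‖interaction S N L' i x.1 x.2.1 x.2.2‖) := by gcongr
      _ = _ := by ring
  have hsq : ∀ {L : Fin n → ℂ}, (∀ i, 0 < (L i).im) →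
      ∑ x : Fin n × Fin p × Fin p,
        ((1 / (n : ℝ)) * (Real.sqrt (L x.1).im / ‖L x.1‖) * ‖interaction S N L i x.1 x.2.1 x.2.2‖) ^ 2
      = (fixedPointMap S z L i).im - z.im := fun {L} hL => by
    rw [im_fixedPointMap hS hN hL]
    refine Finset.sum_congr rfl fun x _ => ?_
    rw [mul_pow, mul_pow, div_pow _ ‖L x.1‖, Real.sq_sqrt (hL x.1).le]
  have hcs := Finset.sum_mul_sq_le_sq_mul_sq (Finset.univ : Finset (Fin n × Fin p × Fin p))
    (fun x => (1 / (n : ℝ)) * (Real.sqrt (L x.1).im / ‖L x.1‖) * ‖interaction S N L i x.1 x.2.1 x.2.2‖)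
    (fun x => (1 / (n : ℝ)) * (Real.sqrt (L' x.1).im / ‖L' x.1‖) * ‖interaction S N L' i x.1 x.2.1 x.2.2‖)
  rw [hsq hL, hsq hL'] at hcs
  calc _ ≤ (Real.sqrt D * _) ^ 2 := by gcongr
    _ ≤ _ := by
      rw [mul_pow, Real.sq_sqrt hD]
      gcongr

/-- At an index where the gauge is maximal, with value `D`, the contraction bound gives `D ab ≤ D (a
- Im z) (b - Im z)` for the two imaginary parts `a, b ≥ Im z`. This is impossible when `D > 0`. -/
theorem isSolution_unique (hS : ∀ i, (S i).PosSemidef) {z : ℂ} (hz : 0 < z.im) {L L' : Fin n → ℂ}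
    (hL : IsSolution S z L) (hL' : IsSolution S z L') : L = L' := by
  rw [isSolution_iff] at hL hL'
  obtain ⟨hL, hF⟩ := hL
  obtain ⟨hL', hF'⟩ := hL'
  by_contra hne
  obtain ⟨i₀, hi₀⟩ := Function.ne_iff.1 hne
  have hpos : ∀ i, 0 < (L i).im * (L' i).im := fun i => mul_pos (hL i) (hL' i)
  obtain ⟨m, -, hm⟩ := Finset.exists_max_image Finset.univ
    (fun i => ‖L i - L' i‖ ^ 2 / ((L i).im * (L' i).im)) ⟨i₀, Finset.mem_univ _⟩
  set D := ‖L m - L' m‖ ^ 2 / ((L m).im * (L' m).im) with hD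
  have hDpos : 0 < D := by
    refine lt_of_lt_of_le ?_ (hm i₀ (Finset.mem_univ _))
    have : L i₀ - L' i₀ ≠ 0 := sub_ne_zero.2 hi₀
    exact div_pos (by positivity) (hpos i₀)
  have h := norm_fixedPointMap_sub_sq_le hS hL hL' hDpos.le
    (fun j => (div_le_iff₀ (hpos j)).1 (hm j (Finset.mem_univ j))) z m
  have h1 := im_le_im_fixedPointMap hS hL z m
  have h2 := im_le_im_fixedPointMap hS hL' z m
  rw [hF] at h h1
  rw [hF'] at h h2
  have h3 : ‖L m - L' m‖ ^ 2 = D * ((L m).im * (L' m).im) := by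
    rw [hD, div_mul_cancel₀ _ (hpos m).ne']
  rw [h3] at h
  have h4 := le_of_mul_le_mul_left h hDpos
  nlinarith

end FixedPointMap

end SampleCovariance

/-! ### Existence of a solution by iteration. -/

namespace SampleCovariance

open Filter Topology Complex Set
open scoped ComplexConjugate Matrix Matrix.Norms.L2Operator

section Solution

variable {n p : ℕ} {S : Fin n → Matrix (Fin p) (Fin p) ℝ} {κ σ : ℝ}

/-- An invariant region of the fixed point map at `z`. -/
def Admissible (z : ℂ) (L : Fin n → ℂ) : Prop :=
  ∀ i, z.im ≤ (L i).im ∧ 0 ≤ (L i * conj z).im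

theorem admissible_const (z : ℂ) : Admissible z (fun _ : Fin n => z) := fun _ =>
  ⟨le_rfl, by rw [Complex.mul_conj']; norm_cast⟩

theorem Admissible.im_pos {z : ℂ} {L : Fin n → ℂ} (hL : Admissible z L) (hz : 0 < z.im) (i : Fin n) :
    0 < (L i).im := hz.trans_le (hL i).1

/-- Since `-z / L_i` is `-z conj L_i` divided by `|L_i|²`, the second admissibility condition is
exactly the sign needed to make the form of `z A` coercive. -/
theorem Admissible.im_neg_div {z : ℂ} {L : Fin n → ℂ} (hL : Admissible z L) (i : Fin n) :
    0 ≤ (-(z / L i)).im := by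
  have h : -(z / L i) = ((‖L i‖ ^ 2)⁻¹ : ℝ) * -(z * conj (L i)) := by
    rw [div_eq_mul_inv, Complex.inv_def, Complex.normSq_eq_norm_sq]
    push_cast
    ring
  rw [h, Complex.im_ofReal_mul]
  refine mul_nonneg (by positivity) ?_
  have := (hL i).2
  simp only [mul_im, conj_re, conj_im, neg_im] at this ⊢
  linarith

theorem Admissible.le_im_star_dotProduct (hS : ∀ i, (S i).PosSemidef) {z : ℂ} {L : Fin n → ℂ}
    (hL : Admissible z L) (v : Fin p → ℂ) :
    z.im * ∑ k, ‖v k‖ ^ 2 ≤ (star v ⬝ᵥ (z • tildeA S L) *ᵥ v).im :=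
  im_star_dotProduct_smul_tildeA_mulVec hS hL.im_neg_div v

theorem tildeQ_eq_smul_inv {z : ℂ} (hz : z ≠ 0) {L : Fin n → ℂ} (hA : (tildeA S L).det ≠ 0) :
    tildeQ S L = z • (z • tildeA S L)⁻¹ := by
  rw [tildeQ_eq_inv]
  refine Matrix.inv_eq_right_inv ?_
  rw [Matrix.mul_smul, ← Matrix.smul_mul, Matrix.mul_nonsing_inv]
  rw [Matrix.det_smul]
  exact isUnit_iff_ne_zero.2 (mul_ne_zero (pow_ne_zero _ hz) hA)

theorem ne_zero_of_im_pos {z : ℂ} (hz : 0 < z.im) : z ≠ 0 := fun h => by simp [h] at hz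

theorem Admissible.norm_tildeQ_le (hS : ∀ i, (S i).PosSemidef) {z : ℂ} (hz : 0 < z.im)
    {L : Fin n → ℂ} (hL : Admissible z L) : ‖tildeQ S L‖ ≤ ‖z‖ / z.im := by
  rw [tildeQ_eq_smul_inv (ne_zero_of_im_pos hz) (det_tildeA_ne_zero hS (hL.im_pos hz)), norm_smul,
    div_eq_mul_one_div]
  gcongr
  exact l2_opNorm_inv_le hz (hL.le_im_star_dotProduct hS)

/-- The product of the new vector with `conj z` is `|z|²` minus a nonnegative multiple of `tr (Σ_i
(z A)⁻¹)`, and that trace has nonpositive imaginary part because the form of `z A` has nonnegative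
imaginary part. -/
theorem Admissible.fixedPointMap (hS : ∀ i, (S i).PosSemidef) {z : ℂ} (hz : 0 < z.im)
    {L : Fin n → ℂ} (hL : Admissible z L) : Admissible z (fixedPointMap S z L) := fun i => by
  refine ⟨im_le_im_fixedPointMap hS (hL.im_pos hz) z i, ?_⟩
  obtain ⟨N, hN⟩ := exists_map_eq_conjTranspose_mul_self (hS i)
  have hdet := det_ne_zero_of_le_im hz (hL.le_im_star_dotProduct hS)
  have h1 := im_trace_conjTranspose_mul_self_mul_inv_nonpos hdet
    (fun v => le_trans (by positivity) (hL.le_im_star_dotProduct hS v)) (N.map Complex.ofReal)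
  have h2 : SampleCovariance.fixedPointMap S z L i * conj z = ((‖z‖ ^ 2 : ℝ) : ℂ) -
      ((‖z‖ ^ 2 / n : ℝ) : ℂ) * ((N.map Complex.ofReal)ᴴ * N.map Complex.ofReal *
        (z • tildeA S L)⁻¹).trace := by
    have h3 : ((‖z‖ ^ 2 : ℝ) : ℂ) = z * conj z := by rw [Complex.mul_conj']; push_cast; rfl
    rw [SampleCovariance.fixedPointMap,
      tildeQ_eq_smul_inv (ne_zero_of_im_pos hz) (det_tildeA_ne_zero hS (hL.im_pos hz)), hN,
      Matrix.mul_smul, Matrix.trace_smul, smul_eq_mul, ofReal_div, h3, ofReal_natCast]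
    ring
  rw [h2, Complex.sub_im, Complex.im_ofReal_mul, ofReal_im, zero_sub]
  exact neg_nonneg.2 (mul_nonpos_of_nonneg_of_nonpos (by positivity) h1)

theorem norm_fixedPointMap_sub_le (hn : 0 < n) (hp : (p : ℝ) ≤ κ * n)
    (hσ : ∀ i, ‖(S i).map Complex.ofReal‖ ≤ σ) (hσ0 : 0 ≤ σ) (z : ℂ) (L : Fin n → ℂ) (i : Fin n) :
    ‖fixedPointMap S z L i - z‖ ≤ κ * σ * ‖tildeQ S L‖ := by
  have hn' : (0 : ℝ) < n := by exact_mod_cast hn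
  have h1 : ‖((S i).map Complex.ofReal * tildeQ S L).trace‖ ≤ p * (σ * ‖tildeQ S L‖) := by
    refine (norm_trace_le _).trans ?_
    gcongr
    exact (norm_mul_le _ _).trans (by gcongr; exact hσ i)
  rw [fixedPointMap, sub_sub_cancel_left, norm_neg, norm_mul, norm_div, norm_one, Complex.norm_natCast]
  calc 1 / (n : ℝ) * ‖((S i).map Complex.ofReal * tildeQ S L).trace‖
      ≤ 1 / (n : ℝ) * (κ * n * (σ * ‖tildeQ S L‖)) := by
        gcongr
        exact h1.trans (by gcongr)
    _ = κ * σ * ‖tildeQ S L‖ := by field_simp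

/-- A general parameter space covers both uses: `E = ℂ` for holomorphy of the iterates, and `E = Fin
n → ℂ` for continuity of the map at the limit. -/
theorem differentiableAt_fixedPointMap {E : Type*} [NormedAddCommGroup E] [NormedSpace ℂ E]
    {ζ : E → ℂ} {L : E → Fin n → ℂ} {x : E} (hζ : DifferentiableAt ℂ ζ x)
    (hL : DifferentiableAt ℂ L x) (hL0 : ∀ i, L x i ≠ 0) (hA : (tildeA S (L x)).det ≠ 0) :
    DifferentiableAt ℂ (fun e => fixedPointMap S (ζ e) (L e)) x := by
  have hdA : DifferentiableAt ℂ (fun e => tildeA S (L e)) x := by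
    refine (differentiableAt_const _).sub (DifferentiableAt.fun_const_smul ?_ _)
    refine DifferentiableAt.fun_sum fun j _ => DifferentiableAt.smul_const ?_ _
    simpa only [one_div] using (differentiableAt_pi.1 hL j).fun_inv (hL0 j)
  have hdQ : DifferentiableAt ℂ (fun e => tildeQ S (L e)) x := by
    simp_rw [tildeQ_eq_inv, Matrix.nonsing_inv_eq_ringInverse]
    have hu : IsUnit (tildeA S (L x)) := (Matrix.isUnit_iff_isUnit_det _).2 (isUnit_iff_ne_zero.2 hA)
    exact DifferentiableAt.comp x (differentiableAt_inverse (𝕜 := ℂ) hu) hdA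
  refine differentiableAt_pi.2 fun i => hζ.sub (DifferentiableAt.const_mul ?_ _)
  exact ((Matrix.traceLinearMap (Fin p) ℂ ℂ).toContinuousLinearMap.differentiableAt).comp x
    (hdQ.const_mul ((S i).map Complex.ofReal))

/-- The iterates of the fixed point map started at the constant vector `z`. -/
noncomputable def iterates (S : Fin n → Matrix (Fin p) (Fin p) ℝ) (m : ℕ) (z : ℂ) : Fin n → ℂ :=
  (fixedPointMap S z)^[m] fun _ => z

theorem iterates_succ (m : ℕ) (z : ℂ) :
    iterates S (m + 1) z = fixedPointMap S z (iterates S m z) :=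
  Function.iterate_succ_apply' _ _ _

theorem admissible_iterates (hS : ∀ i, (S i).PosSemidef) {z : ℂ} (hz : 0 < z.im) (m : ℕ) :
    Admissible z (iterates S m z) := by
  induction m with
  | zero => exact admissible_const z
  | succ m ih => rw [iterates_succ]; exact ih.fixedPointMap hS hz

theorem norm_iterates_le (hS : ∀ i, (S i).PosSemidef) (hn : 0 < n) (hp : (p : ℝ) ≤ κ * n)
    (hκ : 0 ≤ κ) (hσ : ∀ i, ‖(S i).map Complex.ofReal‖ ≤ σ) (hσ0 : 0 ≤ σ) {z : ℂ} {y r : ℝ}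
    (hy : 0 < y) (hz : y ≤ z.im) (hr : ‖z‖ ≤ r) (m : ℕ) (i : Fin n) :
    ‖iterates S m z i‖ ≤ r + κ * σ * (r / y) := by
  have hz' := hy.trans_le hz
  have hr0 : 0 ≤ r := (norm_nonneg _).trans hr
  cases m with
  | zero =>
    have : 0 ≤ κ * σ * (r / y) := by positivity
    exact hr.trans (by linarith)
  | succ m =>
    rw [iterates_succ]
    have h1 := norm_fixedPointMap_sub_le hn hp hσ hσ0 z (iterates S m z) i
    have h2 := norm_le_norm_add_norm_sub' (fixedPointMap S z (iterates S m z) i) z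
    have h3 : ‖tildeQ S (iterates S m z)‖ ≤ r / y :=
      ((admissible_iterates hS hz' m).norm_tildeQ_le hS hz').trans (by gcongr)
    refine h2.trans (add_le_add hr (h1.trans ?_))
    gcongr

/-- An imaginary part bounded by `R` turns the loss of `Im z ≥ y` into a factor: `Im F - Im z ≤ (1 -
y / R) Im F`. The gauge therefore contracts geometrically, and the same bound `R` converts it back
to the norm. -/
theorem norm_iterates_succ_sub_le (hS : ∀ i, (S i).PosSemidef) {z : ℂ} {y R : ℝ} (hy : 0 < y)
    (hz : y ≤ z.im) (hR : ∀ m i, ‖iterates S m z i‖ ≤ R) (m : ℕ) (i : Fin n) :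
    ‖iterates S (m + 1) z i - iterates S m z i‖ ≤ 2 * R ^ 2 / y * (1 - y / R) ^ m := by
  have hz' := hy.trans_le hz
  have him : ∀ m i, y ≤ (iterates S m z i).im := fun m i => hz.trans ((admissible_iterates hS hz' m) i).1
  have himR : ∀ m i, (iterates S m z i).im ≤ R := fun m i =>
    (le_abs_self _).trans ((Complex.abs_im_le_norm _).trans (hR m i))
  have hyR : y ≤ R := (him 0 i).trans (himR 0 i)
  have hR0 : 0 < R := hy.trans_le hyR
  have hq : 0 ≤ 1 - y / R := sub_nonneg.2 ((div_le_one hR0).2 hyR)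
  have key : ∀ m i, ‖iterates S (m + 1) z i - iterates S m z i‖ ^ 2 ≤
      -- The initial constant `2R / y` comes from a first difference of norm at most `2R` and
      -- imaginary parts at least `y`.
      ((2 * R / y) * (1 - y / R) ^ m) ^ 2 * ((iterates S (m + 1) z i).im * (iterates S m z i).im) := by
    intro m
    induction m with
    | zero =>
      intro i
      have h1 : ‖iterates S 1 z i - iterates S 0 z i‖ ≤ 2 * R :=
        (norm_sub_le _ _).trans (by linarith [hR 1 i, hR 0 i])
      have h2 : y * y ≤ (iterates S 1 z i).im * (iterates S 0 z i).im :=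
        mul_le_mul (him 1 i) (him 0 i) hy.le (hy.le.trans (him 1 i))
      calc ‖iterates S 1 z i - iterates S 0 z i‖ ^ 2 ≤ (2 * R) ^ 2 := by gcongr
        _ = (2 * R / y * (1 - y / R) ^ 0) ^ 2 * (y * y) := by field_simp
        _ ≤ _ := by gcongr
    | succ m ih =>
      intro i
      have h1 := norm_fixedPointMap_sub_sq_le hS (fun i => hy.trans_le (him (m + 1) i))
        (fun i => hy.trans_le (him m i)) (sq_nonneg _) ih z i
      rw [← iterates_succ, ← iterates_succ] at h1
      refine h1.trans ?_
      have h2 : ∀ m, (iterates S m z i).im - z.im ≤ (1 - y / R) * (iterates S m z i).im := fun m => by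
        have : y / R * (iterates S m z i).im ≤ y := by
          rw [div_mul_eq_mul_div, div_le_iff₀ hR0]
          exact mul_le_mul_of_nonneg_left (himR m i) hy.le
        linarith
      calc _ ≤ (2 * R / y * (1 - y / R) ^ m) ^ 2 * (((1 - y / R) * (iterates S (m + 2) z i).im) *
            ((1 - y / R) * (iterates S (m + 1) z i).im)) := by
            gcongr
            · exact sub_nonneg.2 ((admissible_iterates hS hz' (m + 1)) i).1
            · exact mul_nonneg hq (hy.le.trans (him _ i))
            · exact h2 (m + 2)
            · exact h2 (m + 1)
        _ = _ := by ring
  have h := key m i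
  have h2 : (iterates S (m + 1) z i).im * (iterates S m z i).im ≤ R ^ 2 := by
    rw [sq]
    exact mul_le_mul (himR _ i) (himR _ i) (hy.le.trans (him _ i)) hR0.le
  refine le_of_sq_le_sq ?_ (by positivity)
  calc _ ≤ _ := h
    _ ≤ (2 * R / y * (1 - y / R) ^ m) ^ 2 * R ^ 2 := by gcongr
    _ = _ := by ring

/-- The iterates converge to a solution, at a geometric rate that is locally uniform in `z`. -/
theorem exists_isSolution_dist_iterates_le (hS : ∀ i, (S i).PosSemidef) {z : ℂ} {y R : ℝ}
    (hy : 0 < y) (hz : y ≤ z.im) (hyR : y ≤ R) (hR : ∀ m i, ‖iterates S m z i‖ ≤ R) :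
    ∃ L, IsSolution S z L ∧ Tendsto (fun m => iterates S m z) atTop (𝓝 L) ∧
      ∀ m, dist (iterates S m z) L ≤ 2 * R ^ 2 / y * (1 - y / R) ^ m / (1 - (1 - y / R)) := by
  have hz' := hy.trans_le hz
  have hR0 : 0 < R := hy.trans_le hyR
  have hq : 0 ≤ 1 - y / R := sub_nonneg.2 ((div_le_one hR0).2 hyR)
  have hq1 : 1 - y / R < 1 := by have : 0 < y / R := by positivity
                                 linarith
  have hd : ∀ m, dist (iterates S m z) (iterates S (m + 1) z) ≤ 2 * R ^ 2 / y * (1 - y / R) ^ m :=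
    fun m => (dist_pi_le_iff (by positivity)).2 fun i => by
      rw [dist_comm, dist_eq_norm]
      exact norm_iterates_succ_sub_le hS hy hz hR m i
  obtain ⟨L, hL⟩ := cauchySeq_tendsto_of_complete (cauchySeq_of_le_geometric _ _ hq1 hd)
  have him : ∀ i, 0 < (L i).im := fun i => hz'.trans_le <| ge_of_tendsto'
    ((Complex.continuous_im.tendsto _).comp (tendsto_pi_nhds.1 hL i))
    fun m => ((admissible_iterates hS hz' m) i).1
  refine ⟨L, isSolution_iff.2 ⟨him, ?_⟩, hL, fun m => dist_le_of_le_geometric_of_tendsto _ _ hq1 hd hL m⟩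
  have hc : ContinuousAt (fixedPointMap S z) L :=
    (differentiableAt_fixedPointMap (ζ := fun _ => z) (L := fun L => L) (differentiableAt_const _)
      differentiableAt_id (fun i => ne_zero_of_im_pos (him i)) (det_tildeA_ne_zero hS him)).continuousAt
  have h1 := hc.tendsto.comp hL
  refine tendsto_nhds_unique h1 (((tendsto_add_atTop_iff_nat 1).2 hL).congr fun m => ?_)
  exact iterates_succ m z

end Solution

end SampleCovariance

/-! ### The solution: analyticity and bounds for large `z`. -/

namespace SampleCovariance

open Filter Topology Complex Set
open scoped ComplexConjugate Matrix Matrix.Norms.L2Operator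

/-- A nonempty family of positive semidefinite matrices whose size is at most `κ` times their number and
whose operator norms are at most `σ`. -/
structure IsBoundedFamily {n p : ℕ} (S : Fin n → Matrix (Fin p) (Fin p) ℝ) (κ σ : ℝ) : Prop where
  card_pos : 0 < n
  posSemidef : ∀ i, (S i).PosSemidef
  ratio_nonneg : 0 ≤ κ
  size_le : (p : ℝ) ≤ κ * n
  bound_nonneg : 0 ≤ σ
  norm_le : ∀ i, ‖(S i).map Complex.ofReal‖ ≤ σ

theorem exists_isBoundedFamily {n p : ℕ} {S : Fin n → Matrix (Fin p) (Fin p) ℝ} (hn : 0 < n)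
    (hS : ∀ i, (S i).PosSemidef) : ∃ κ σ, IsBoundedFamily S κ σ := by
  refine ⟨p, ∑ i, ‖(S i).map Complex.ofReal‖, hn, hS, p.cast_nonneg, ?_,
    Finset.sum_nonneg fun i _ => norm_nonneg _, fun i =>
      Finset.single_le_sum (f := fun i => ‖(S i).map Complex.ofReal‖) (fun i _ => norm_nonneg _)
        (Finset.mem_univ i)⟩
  have : (1 : ℝ) ≤ n := by exact_mod_cast hn
  exact le_mul_of_one_le_right p.cast_nonneg this

namespace IsBoundedFamily

variable {n p : ℕ} {S : Fin n → Matrix (Fin p) (Fin p) ℝ} {κ σ : ℝ} (h : IsBoundedFamily S κ σ)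

include h

theorem exists_dist_iterates_le {z : ℂ} {y r : ℝ} (hy : 0 < y) (hz : y ≤ z.im) (hr : ‖z‖ ≤ r) :
    ∃ L, IsSolution S z L ∧ Tendsto (fun m => iterates S m z) atTop (𝓝 L) ∧
      ∀ m, dist (iterates S m z) L ≤ 2 * (r + κ * σ * (r / y)) ^ 2 / y *
        (1 - y / (r + κ * σ * (r / y))) ^ m / (1 - (1 - y / (r + κ * σ * (r / y)))) := by
  have hyr : y ≤ r := hz.trans ((le_abs_self _).trans ((Complex.abs_im_le_norm z).trans hr))
  have h0 : 0 ≤ κ * σ * (r / y) :=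
    mul_nonneg (mul_nonneg h.ratio_nonneg h.bound_nonneg) (div_nonneg (hy.le.trans hyr) hy.le)
  exact exists_isSolution_dist_iterates_le h.posSemidef hy hz (by linarith)
    (norm_iterates_le h.posSemidef h.card_pos h.size_le h.ratio_nonneg h.norm_le h.bound_nonneg hy hz hr)

theorem existsUnique_isSolution {z : ℂ} (hz : 0 < z.im) : ∃! L : Fin n → ℂ, IsSolution S z L := by
  obtain ⟨L, hL, -⟩ := h.exists_dist_iterates_le hz le_rfl le_rfl
  exact ⟨L, hL, fun L' hL' => isSolution_unique h.posSemidef hz hL' hL⟩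

theorem isSolution_tildeLambda {z : ℂ} (hz : 0 < z.im) : IsSolution S z (tildeLambda S z) :=
  Classical.epsilon_spec (h.existsUnique_isSolution hz).exists

theorem dist_iterates_tildeLambda_le {z : ℂ} {y r : ℝ} (hy : 0 < y) (hz : y ≤ z.im) (hr : ‖z‖ ≤ r)
    (m : ℕ) : dist (iterates S m z) (tildeLambda S z) ≤ 2 * (r + κ * σ * (r / y)) ^ 2 / y *
        (1 - y / (r + κ * σ * (r / y))) ^ m / (1 - (1 - y / (r + κ * σ * (r / y)))) := by
  obtain ⟨L, hL, -, hd⟩ := h.exists_dist_iterates_le hy hz hr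
  rw [isSolution_unique h.posSemidef (hy.trans_le hz) (h.isSolution_tildeLambda (hy.trans_le hz)) hL]
  exact hd m

theorem tendsto_iterates {z : ℂ} (hz : 0 < z.im) :
    Tendsto (fun m => iterates S m z) atTop (𝓝 (tildeLambda S z)) := by
  obtain ⟨L, hL, hlim, -⟩ := h.exists_dist_iterates_le hz le_rfl le_rfl
  rwa [isSolution_unique h.posSemidef hz (h.isSolution_tildeLambda hz) hL]

theorem tildeLambda_im_pos {z : ℂ} (hz : 0 < z.im) (i : Fin n) : 0 < (tildeLambda S z i).im :=
  (h.isSolution_tildeLambda hz).1 i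

theorem fixedPointMap_tildeLambda {z : ℂ} (hz : 0 < z.im) :
    fixedPointMap S z (tildeLambda S z) = tildeLambda S z :=
  (isSolution_iff.1 (h.isSolution_tildeLambda hz)).2

/-- Being a solution does not by itself include the condition on `L_i conj z`; it is closed, so it
passes from the iterates to their limit. -/
theorem admissible_tildeLambda {z : ℂ} (hz : 0 < z.im) : Admissible z (tildeLambda S z) := fun i => by
  have h1 := tendsto_pi_nhds.1 (h.tendsto_iterates hz) i
  have h2 := admissible_iterates h.posSemidef hz
  exact ⟨ge_of_tendsto' ((Complex.continuous_im.tendsto _).comp h1) fun m => (h2 m i).1,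
    ge_of_tendsto' ((Complex.continuous_im.tendsto _).comp (h1.mul_const _)) fun m => (h2 m i).2⟩

theorem differentiableOn_iterates (m : ℕ) :
    DifferentiableOn ℂ (iterates S m) {z | 0 < z.im} := by
  induction m with
  | zero => exact (differentiable_pi.2 fun _ => differentiable_id).differentiableOn
  | succ m ih =>
    intro z hz
    have him := fun i => (admissible_iterates h.posSemidef hz m).im_pos hz i
    have hopen : IsOpen {z : ℂ | 0 < z.im} := isOpen_lt continuous_const Complex.continuous_im
    have h1 := differentiableAt_fixedPointMap (S := S) (ζ := fun z => z) (L := iterates S m) (x := z)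
      differentiableAt_id (ih.differentiableAt (hopen.mem_nhds hz)) (fun i => ne_zero_of_im_pos (him i))
      (det_tildeA_ne_zero h.posSemidef him)
    simp_rw [← iterates_succ] at h1
    exact h1.differentiableWithinAt

/-- Near `z`, the lower bound `Im z / 2` on imaginary parts and the upper bound `|z| + 1` on norms
fix a single geometric rate. -/
theorem tendstoLocallyUniformlyOn_iterates :
    TendstoLocallyUniformlyOn (iterates S) (tildeLambda S) atTop {z | 0 < z.im} := by
  rw [Metric.tendstoLocallyUniformlyOn_iff]
  intro ε hε z (hz : 0 < z.im)
  set y := z.im / 2 with hy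
  have hy0 : 0 < y := by positivity
  set r := ‖z‖ + 1 with hr
  set R := r + κ * σ * (r / y) with hR
  have hyr : y ≤ r := by linarith [(le_abs_self _).trans (Complex.abs_im_le_norm z)]
  have hyR : y ≤ R := by
    have h0 : 0 ≤ κ * σ * (r / y) :=
      mul_nonneg (mul_nonneg h.ratio_nonneg h.bound_nonneg) (div_nonneg (hy0.le.trans hyr) hy0.le)
    linarith
  have hR0 : 0 < R := hy0.trans_le hyR
  have hq : 0 ≤ 1 - y / R := sub_nonneg.2 ((div_le_one hR0).2 hyR)
  have hq1 : 1 - y / R < 1 := sub_lt_self _ (by positivity)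
  refine ⟨{w | y < w.im} ∩ {w | ‖w‖ < r}, mem_nhdsWithin_of_mem_nhds (inter_mem ?_ ?_), ?_⟩
  · exact (isOpen_lt continuous_const Complex.continuous_im).mem_nhds (by
      change y < z.im
      linarith)
  · exact (isOpen_lt continuous_norm continuous_const).mem_nhds (by
      change ‖z‖ < r
      linarith)
  · have hlim : Tendsto (fun m : ℕ => 2 * R ^ 2 / y * (1 - y / R) ^ m / (1 - (1 - y / R))) atTop (𝓝 0) := by
      simpa using ((tendsto_pow_atTop_nhds_zero_of_lt_one hq hq1).const_mul (2 * R ^ 2 / y)).div_const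
        (1 - (1 - y / R))
    filter_upwards [hlim.eventually (gt_mem_nhds hε)] with m hm w hw
    rw [dist_comm]
    exact (h.dist_iterates_tildeLambda_le hy0 (le_of_lt hw.1) (le_of_lt hw.2) m).trans_lt hm

theorem differentiableOn_tildeLambda : DifferentiableOn ℂ (tildeLambda S) {z | 0 < z.im} :=
  h.tendstoLocallyUniformlyOn_iterates.differentiableOn (.of_forall h.differentiableOn_iterates)
    (isOpen_lt continuous_const Complex.continuous_im)

theorem analyticOnNhd_tildeLambda : AnalyticOnNhd ℂ (tildeLambda S) {z | 0 < z.im} :=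
  h.differentiableOn_tildeLambda.analyticOnNhd (isOpen_lt continuous_const Complex.continuous_im)

/-- Here `‖1 - A‖ ≤ 2σ / |z| ≤ 1/2`, and `Q = 1 + (1 - A) Q` gives `‖Q‖ ≤ 1 + ‖Q‖ / 2`. -/
theorem norm_tildeQ_le_two {z : ℂ} (hz : 0 < z.im) (hB : 4 * σ * (1 + κ) ≤ ‖z‖) {L : Fin n → ℂ}
    (him : ∀ i, 0 < (L i).im) (hL : ∀ i, ‖z‖ / 2 ≤ ‖L i‖) : ‖tildeQ S L‖ ≤ 2 := by
  have hz0 : 0 < ‖z‖ := norm_pos_iff.2 (ne_zero_of_im_pos hz)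
  have hn : (0 : ℝ) < n := by exact_mod_cast h.card_pos
  have h1 : ‖1 - tildeA S L‖ ≤ 1 / 2 := by
    rw [tildeA, sub_sub_cancel, norm_smul, norm_div, norm_one, Complex.norm_natCast]
    have h2 : ‖∑ i, (1 / L i) • (S i).map Complex.ofReal‖ ≤ ∑ _ : Fin n, σ / (‖z‖ / 2) := by
      refine norm_sum_le_of_le _ fun i _ => ?_
      rw [norm_smul, norm_div, norm_one, one_div_mul_eq_div]
      exact div_le_div₀ h.bound_nonneg (h.norm_le i) (by positivity) (hL i)
    rw [Finset.sum_const, Finset.card_univ, Fintype.card_fin, nsmul_eq_mul] at h2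
    calc 1 / (n : ℝ) * ‖∑ i, (1 / L i) • (S i).map Complex.ofReal‖
        ≤ 1 / (n : ℝ) * (n * (σ / (‖z‖ / 2))) := by gcongr
      _ = 2 * σ / ‖z‖ := by field_simp
      _ ≤ 1 / 2 := by
        rw [div_le_iff₀ hz0]
        nlinarith [mul_nonneg h.bound_nonneg h.ratio_nonneg]
  have h2 : tildeQ S L = 1 + (1 - tildeA S L) * tildeQ S L := by
    rw [sub_mul, one_mul, tildeQ_eq_inv,
      Matrix.mul_nonsing_inv _ (isUnit_iff_ne_zero.2 (det_tildeA_ne_zero h.posSemidef him))]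
    abel
  have h3 : ‖(1 : Matrix (Fin p) (Fin p) ℂ)‖ ≤ 1 :=
    l2_opNorm_le_of_forall zero_le_one fun v => by simp
  have h4 : ‖tildeQ S L‖ ≤ 1 + 1 / 2 * ‖tildeQ S L‖ := by
    conv_lhs => rw [h2]
    refine (norm_add_le _ _).trans (add_le_add h3 ((norm_mul_le _ _).trans ?_))
    gcongr
  linarith

theorem norm_fixedPointMap_sub_le_of_large {z : ℂ} (hz : 0 < z.im) (hB : 4 * σ * (1 + κ) ≤ ‖z‖)
    {L : Fin n → ℂ} (him : ∀ i, 0 < (L i).im) (hL : ∀ i, ‖z‖ / 2 ≤ ‖L i‖) (i : Fin n) :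
    ‖fixedPointMap S z L i - z‖ ≤ 2 * (κ * σ) := by
  refine (norm_fixedPointMap_sub_le h.card_pos h.size_le h.norm_le h.bound_nonneg z L i).trans ?_
  have := mul_le_mul_of_nonneg_left (h.norm_tildeQ_le_two hz hB him hL)
    (mul_nonneg h.ratio_nonneg h.bound_nonneg)
  linarith

/-- Induction closes the loop: a vector with entries of size at least `|z| / 2` is mapped within
`2κσ ≤ |z| / 2` of `z`. Working with iterates avoids assuming this size for the solution. -/
theorem half_norm_le_norm_iterates {z : ℂ} (hz : 0 < z.im) (hB : 4 * σ * (1 + κ) ≤ ‖z‖) (m : ℕ)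
    (i : Fin n) : ‖z‖ / 2 ≤ ‖iterates S m z i‖ := by
  induction m generalizing i with
  | zero =>
    have : 0 ≤ ‖z‖ := norm_nonneg z
    change ‖z‖ / 2 ≤ ‖z‖
    linarith
  | succ m ih =>
    rw [iterates_succ]
    have h1 := h.norm_fixedPointMap_sub_le_of_large hz hB
      (fun i => (admissible_iterates h.posSemidef hz m).im_pos hz i) ih i
    have h2 := norm_sub_norm_le z (fixedPointMap S z (iterates S m z) i)
    rw [norm_sub_rev] at h2
    nlinarith [h.bound_nonneg]

theorem half_norm_le_norm_tildeLambda {z : ℂ} (hz : 0 < z.im) (hB : 4 * σ * (1 + κ) ≤ ‖z‖)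
    (i : Fin n) : ‖z‖ / 2 ≤ ‖tildeLambda S z i‖ :=
  ge_of_tendsto' (tendsto_pi_nhds.1 (h.tendsto_iterates hz) i).norm
    fun m => h.half_norm_le_norm_iterates hz hB m i

theorem norm_tildeLambda_sub_le {z : ℂ} (hz : 0 < z.im) (hB : 4 * σ * (1 + κ) ≤ ‖z‖) (i : Fin n) :
    ‖tildeLambda S z i - z‖ ≤ 2 * (κ * σ) := by
  have h1 := h.norm_fixedPointMap_sub_le_of_large hz hB (h.tildeLambda_im_pos hz)
    (h.half_norm_le_norm_tildeLambda hz hB) i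
  rwa [h.fixedPointMap_tildeLambda hz] at h1

/-- The sum is a trace involving `Q` at `L` and at `conj L`, which have equal norms. Bounding the
trace by `p` times the operator norm costs only a factor `κ n`. -/
theorem sum_norm_interaction_sq_le {N : Fin n → Matrix (Fin p) (Fin p) ℝ}
    (hN : ∀ i, (S i).map Complex.ofReal = ((N i).map Complex.ofReal)ᵀ * (N i).map Complex.ofReal)
    (L : Fin n → ℂ) (i j : Fin n) :
    ∑ x : Fin p × Fin p, ‖interaction S N L i j x.1 x.2‖ ^ 2 ≤ κ * n * (σ * ‖tildeQ S L‖) ^ 2 := by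
  have h1 := trace_mul_mul_mul_eq_sum (N := (N i).map Complex.ofReal) (N' := (N j).map Complex.ofReal)
    (Q := tildeQ S L) (transpose_tildeQ h.posSemidef fun i => conj (L i))
  rw [← hN, ← hN] at h1
  have h2 : ∑ x : Fin p × Fin p, ((N i).map Complex.ofReal * tildeQ S L * ((N j).map Complex.ofReal)ᵀ) x.1 x.2 *
      ((N i).map Complex.ofReal * tildeQ S (fun i => conj (L i)) * ((N j).map Complex.ofReal)ᵀ) x.1 x.2
      = ((∑ x : Fin p × Fin p, ‖interaction S N L i j x.1 x.2‖ ^ 2 : ℝ) : ℂ) := by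
    rw [ofReal_sum]
    refine Finset.sum_congr rfl fun x _ => ?_
    change interaction S N L i j x.1 x.2 * interaction S N (fun i => conj (L i)) i j x.1 x.2 = _
    rw [interaction_conj h.posSemidef, Matrix.map_apply, Complex.mul_conj']
    push_cast
    rfl
  rw [h2] at h1
  have h3 : ‖tildeQ S fun i => conj (L i)‖ = ‖tildeQ S L‖ := by
    rw [tildeQ_eq_inv, ← conjTranspose_tildeA h.posSemidef, ← Matrix.conjTranspose_nonsing_inv,
      Matrix.l2_opNorm_conjTranspose, tildeQ_eq_inv]
  have h4 : ‖(S i).map Complex.ofReal * tildeQ S L * (S j).map Complex.ofReal *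
      tildeQ S (fun i => conj (L i))‖ ≤ σ * ‖tildeQ S L‖ * σ * ‖tildeQ S L‖ := by
    refine (norm_mul_le _ _).trans ?_
    rw [h3]
    have hσ := h.bound_nonneg
    gcongr
    refine (norm_mul_le _ _).trans ?_
    gcongr
    · refine (norm_mul_le _ _).trans ?_
      gcongr
      exact h.norm_le i
    · exact h.norm_le j
  have h5 := norm_trace_le ((S i).map Complex.ofReal * tildeQ S L * (S j).map Complex.ofReal *
      tildeQ S (fun i => conj (L i)))
  rw [h1, Complex.norm_real, Real.norm_of_nonneg (by positivity)] at h5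
  refine h5.trans ?_
  calc (p : ℝ) * _ ≤ κ * n * (σ * ‖tildeQ S L‖ * σ * ‖tildeQ S L‖) :=
        mul_le_mul h.size_le h4 (norm_nonneg _) (mul_nonneg h.ratio_nonneg n.cast_nonneg)
    _ = _ := by ring

/-- At the index with the largest imaginary part `M`, the formula for `Im F` gives `M - Im z ≤ M *
(16 κ σ² / |z|²) ≤ M / 2`. -/
theorem im_tildeLambda_le_two_mul {z : ℂ} (hz : 0 < z.im) (hB : 4 * σ * (1 + κ) ≤ ‖z‖) (i : Fin n) :
    (tildeLambda S z i).im ≤ 2 * z.im := by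
  obtain ⟨N, hN⟩ := exists_map_eq_transpose_mul_self h.posSemidef
  obtain ⟨m, -, hm⟩ := Finset.exists_max_image Finset.univ (fun i => (tildeLambda S z i).im)
    ⟨i, Finset.mem_univ i⟩
  refine (hm i (Finset.mem_univ i)).trans ?_
  have hz0 : 0 < ‖z‖ := norm_pos_iff.2 (ne_zero_of_im_pos hz)
  have hn : (0 : ℝ) < n := by exact_mod_cast h.card_pos
  have h1 := im_fixedPointMap h.posSemidef hN (h.tildeLambda_im_pos hz) z m
  rw [h.fixedPointMap_tildeLambda hz, Fintype.sum_prod_type] at h1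
  have hlarge := h.half_norm_le_norm_tildeLambda hz hB
  set M := (tildeLambda S z m).im with hM
  have hM0 : 0 < M := h.tildeLambda_im_pos hz m
  have hq := h.norm_tildeQ_le_two hz hB (h.tildeLambda_im_pos hz) hlarge
  have h2 : ∀ j : Fin n, ∑ x : Fin p × Fin p, (1 / (n : ℝ)) ^ 2 *
      ((tildeLambda S z j).im / ‖tildeLambda S z j‖ ^ 2) *
        ‖interaction S N (tildeLambda S z) m j x.1 x.2‖ ^ 2 ≤ M / (2 * n) := fun j => by
    rw [← Finset.mul_sum]
    have h3 : (tildeLambda S z j).im / ‖tildeLambda S z j‖ ^ 2 ≤ M / (‖z‖ / 2) ^ 2 := by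
      gcongr
      · exact hm j (Finset.mem_univ j)
      · exact hlarge j
    have h4 := (h.sum_norm_interaction_sq_le hN (tildeLambda S z) m j)
    have h5 : (σ * ‖tildeQ S (tildeLambda S z)‖) ^ 2 ≤ (σ * 2) ^ 2 := by
      have := h.bound_nonneg
      gcongr
    have hκ := h.ratio_nonneg
    have hσ := h.bound_nonneg
    -- From `(1 + κ)² ≥ 4κ` one gets `|z|² ≥ 64 κ σ²`, more than enough.
    have h6 : 32 * κ * σ ^ 2 ≤ ‖z‖ ^ 2 := by
      have : (4 * σ * (1 + κ)) ^ 2 ≤ ‖z‖ ^ 2 := by gcongr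
      nlinarith [sq_nonneg (σ * (1 - κ))]
    calc _ ≤ (1 / (n : ℝ)) ^ 2 * (M / (‖z‖ / 2) ^ 2) * (κ * n * (σ * 2) ^ 2) := by
          gcongr
          exact h4.trans (by gcongr)
      _ = M / (2 * n) * (32 * κ * σ ^ 2 / ‖z‖ ^ 2) := by field_simp; ring
      _ ≤ M / (2 * n) * 1 := by
          gcongr
          exact div_le_one_of_le₀ h6 (by positivity)
      _ = M / (2 * n) := mul_one _
  have h3 : M - z.im ≤ ∑ _ : Fin n, M / (2 * n) := h1.le.trans (Finset.sum_le_sum fun j _ => h2 j)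
  rw [Finset.sum_const, Finset.card_univ, Fintype.card_fin, nsmul_eq_mul] at h3
  have h4 : (n : ℝ) * (M / (2 * n)) = M / 2 := by field_simp
  linarith

end IsBoundedFamily

end SampleCovariance

/-! ### The representing measures, their supports and the mass at the origin. -/

namespace SampleCovariance

open Filter Topology Complex Set
open scoped ComplexConjugate Matrix Matrix.Norms.L2Operator

/-- A bound on the imaginary part of a Stieltjes transform confines the support to a compact interval. -/
theorem support_subset_Icc_of_im_le {f : ℂ → ℂ} (μ : Measure ℝ) [IsFiniteMeasure μ]
    (hμ : IsStieltjesTransform f μ) {B C : ℝ} (hB : 0 ≤ B) (hC : 0 ≤ C)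
    (h : ∀ z : ℂ, 0 < z.im → z.re < 0 ∨ z.re ≠ 0 ∧ B ≤ ‖z‖ → (f z).im ≤ C * (z.im / z.re ^ 2)) :
    μ.support ⊆ Icc 0 B := by
  intro x₀ hx₀
  by_contra hx
  -- The parameter `η` keeps `Re z` away from `0`, so that `Im z / (Re z)²` is at most a fixed
  -- multiple of `Im z` near `x₀`.
  have key : ∀ δ η : ℝ, 0 < δ → 0 < η →
      (∀ z : ℂ, |z.re - x₀| < δ → (z.re < 0 ∨ z.re ≠ 0 ∧ B ≤ ‖z‖) ∧ η ≤ |z.re|) → False := by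
    intro δ η hδ hη hz
    refine notMem_support_of_im_le μ (x₀ := x₀) (C := C / η ^ 2) hδ (fun z h1 _ h3 => ?_) hx₀
    rw [← hμ z h1]
    obtain ⟨h4, h5⟩ := hz z h3
    refine (h z h1 h4).trans ?_
    rw [div_mul_eq_mul_div, mul_div_assoc, ← sq_abs z.re]
    gcongr
  rw [mem_Icc, not_and_or, not_le, not_le] at hx
  rcases hx with hx | hx
  · refine key (-x₀ / 2) (-x₀ / 2) (by linarith) (by linarith) fun z hz => ?_
    rw [abs_lt] at hz
    have : z.re < 0 := by linarith
    exact ⟨Or.inl this, by rw [abs_of_neg this]; linarith⟩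
  · refine key ((x₀ - B) / 2) ((x₀ + B) / 2) (by linarith) (by linarith) fun z hz => ?_
    rw [abs_lt] at hz
    have h1 : (x₀ + B) / 2 ≤ z.re := by linarith
    have h2 : 0 < z.re := by linarith
    refine ⟨Or.inr ⟨h2.ne', ?_⟩, h1.trans (le_abs_self _)⟩
    have := (le_abs_self _).trans (Complex.abs_re_le_norm z)
    linarith

namespace IsBoundedFamily

variable {n p : ℕ} {S : Fin n → Matrix (Fin p) (Fin p) ℝ} {κ σ : ℝ} (h : IsBoundedFamily S κ σ)

include h

theorem im_neg_inv_tildeLambda_nonneg {z : ℂ} (hz : 0 < z.im) (i : Fin n) :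
    0 ≤ (-1 / tildeLambda S z i).im := by
  rw [neg_div, im_neg_one_div]
  have := h.tildeLambda_im_pos hz i
  positivity

theorem im_neg_inv_tildeLambda_le_of_large {z : ℂ} (hz : 0 < z.im) (hB : 4 * σ * (1 + κ) ≤ ‖z‖)
    (i : Fin n) : (-1 / tildeLambda S z i).im ≤ 8 * z.im / ‖z‖ ^ 2 := by
  have hz0 : 0 < ‖z‖ := norm_pos_iff.2 (ne_zero_of_im_pos hz)
  rw [neg_div, im_neg_one_div]
  calc (tildeLambda S z i).im / ‖tildeLambda S z i‖ ^ 2 ≤ 2 * z.im / (‖z‖ / 2) ^ 2 := by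
        gcongr
        · exact h.im_tildeLambda_le_two_mul hz hB i
        · exact h.half_norm_le_norm_tildeLambda hz hB i
    _ = 8 * z.im / ‖z‖ ^ 2 := by field_simp; norm_num

/-- Put `z = x + i y` and `Λ_i = a + i b`. Admissibility gives `b |x| ≤ y |a|` and `b ≥ y`, hence `b
x² ≤ y a²`. No lower bound on `|z|` is needed. -/
theorem im_neg_inv_tildeLambda_le_of_re_neg {z : ℂ} (hz : 0 < z.im) (hre : z.re < 0) (i : Fin n) :
    (-1 / tildeLambda S z i).im ≤ z.im / z.re ^ 2 := by
  obtain ⟨h1, h2⟩ := h.admissible_tildeLambda hz i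
  have h3 := h.tildeLambda_im_pos hz i
  rw [neg_div, im_neg_one_div, div_le_div_iff₀ (by have := ne_zero_of_im_pos h3; positivity)
    (by have := hre.ne; positivity), ← Complex.normSq_eq_norm_sq, Complex.normSq_apply]
  simp only [mul_im, conj_re, conj_im] at h2
  generalize (tildeLambda S z i).re = a at *
  generalize (tildeLambda S z i).im = b at *
  generalize z.re = x at *
  generalize z.im = y at *
  have h4 : b * -x ≤ y * -a := by linarith
  have h5 : (b * -x) ^ 2 ≤ (y * -a) ^ 2 := by
    have : 0 ≤ b * -x := mul_nonneg h3.le (by linarith)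
    gcongr
  have h6 : y * (b * x ^ 2) ≤ y * (y * (a * a)) := by
    calc y * (b * x ^ 2) ≤ b * (b * x ^ 2) := by gcongr
      _ = (b * -x) ^ 2 := by ring
      _ ≤ _ := h5
      _ = _ := by ring
  nlinarith [le_of_mul_le_mul_left h6 hz, mul_pos hz (mul_pos h3 h3)]

theorem im_neg_inv_tildeLambda_le {z : ℂ} (hz : 0 < z.im)
    (hB : z.re < 0 ∨ z.re ≠ 0 ∧ 4 * σ * (1 + κ) ≤ ‖z‖) (i : Fin n) :
    (-1 / tildeLambda S z i).im ≤ 8 * (z.im / z.re ^ 2) := by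
  rcases hB with hB | ⟨hre, hB⟩
  · have := h.im_neg_inv_tildeLambda_le_of_re_neg hz hB i
    have : 0 ≤ z.im / z.re ^ 2 := by positivity
    linarith
  · refine (h.im_neg_inv_tildeLambda_le_of_large hz hB i).trans ?_
    rw [mul_div_assoc, ← sq_abs z.re]
    gcongr
    exact Complex.abs_re_le_norm z

theorem radius_nonneg : 0 ≤ 4 * σ * (1 + κ) := by
  have := h.ratio_nonneg
  have := h.bound_nonneg
  positivity

theorem tendsto_neg_mul_neg_inv_tildeLambda (i : Fin n) :
    Tendsto (fun y : ℝ => -(y * I) * (-1 / tildeLambda S (y * I) i)) atTop (𝓝 1) := by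
  rw [tendsto_iff_norm_sub_tendsto_zero]
  refine squeeze_zero' (.of_forall fun _ => norm_nonneg _) (g := fun y : ℝ => 4 * (κ * σ) * y⁻¹) ?_
    (by simpa using tendsto_inv_atTop_zero.const_mul (4 * (κ * σ)))
  filter_upwards [eventually_gt_atTop 0, eventually_ge_atTop (4 * σ * (1 + κ))] with y hy0 hyB
  have hz : 0 < ((y : ℂ) * I).im := by simpa using hy0
  have hnorm : ‖(y : ℂ) * I‖ = y := by simp [abs_of_pos hy0]
  have hB : 4 * σ * (1 + κ) ≤ ‖(y : ℂ) * I‖ := by rwa [hnorm]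
  have h1 := h.norm_tildeLambda_sub_le hz hB i
  have h2 := h.half_norm_le_norm_tildeLambda hz hB i
  rw [hnorm] at h2
  have hL := ne_zero_of_im_pos (h.tildeLambda_im_pos hz i)
  have h3 : -(y * I) * (-1 / tildeLambda S (y * I) i) - 1
      = -((tildeLambda S (y * I) i - y * I) / tildeLambda S (y * I) i) := by
    field_simp
    ring
  rw [h3, norm_neg, norm_div]
  calc _ ≤ 2 * (κ * σ) / (y / 2) :=
        div_le_div₀ (mul_nonneg zero_le_two (mul_nonneg h.ratio_nonneg h.bound_nonneg)) h1
          (by positivity) h2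
    _ = 4 * (κ * σ) * y⁻¹ := by field_simp; ring

/-- The functions `-1 / Λ_i` are Stieltjes transforms of compactly supported probability measures. -/
theorem exists_measure_neg_inv_tildeLambda (i : Fin n) :
    ∃ ν : Measure ℝ, IsProbabilityMeasure ν ∧ ν.support ⊆ Icc 0 (4 * σ * (1 + κ)) ∧
      IsStieltjesTransform (fun z => -1 / tildeLambda S z i) ν := by
  have hdiff : DifferentiableOn ℂ (fun z => -1 / tildeLambda S z i) {z | 0 < z.im} :=
    (differentiableOn_const _).div (differentiableOn_pi.1 h.differentiableOn_tildeLambda i)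
      fun z hz => ne_zero_of_im_pos (h.tildeLambda_im_pos hz i)
  obtain ⟨ν, hν, hS⟩ := exists_isStieltjesTransform (B := 4 * σ * (1 + κ)) (M := 2) (C := 8) hdiff
    (fun z hz => h.im_neg_inv_tildeLambda_nonneg hz i) (fun z hz hB => by
      have hz0 : 0 < ‖z‖ := norm_pos_iff.2 (ne_zero_of_im_pos hz)
      rw [norm_div, norm_neg, norm_one]
      calc 1 / ‖tildeLambda S z i‖ ≤ 1 / (‖z‖ / 2) := by
            gcongr
            exact h.half_norm_le_norm_tildeLambda hz hB i
        _ = 2 / ‖z‖ := by field_simp) (by norm_num)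
    (fun z hz hB => h.im_neg_inv_tildeLambda_le_of_large hz hB i)
    (h.tendsto_neg_mul_neg_inv_tildeLambda i)
  exact ⟨ν, hν, support_subset_Icc_of_im_le ν hS h.radius_nonneg (C := 8) (by norm_num)
    fun z hz hB => h.im_neg_inv_tildeLambda_le hz hB i, hS⟩

/-- In the trace of `A Q = 1`, the fixed point equation replaces each `(1/n) tr (Σ_i Q)` by `z -
Λ_i`. -/
theorem trace_tildeQ {z : ℂ} (hz : 0 < z.im) :
    (tildeQ S (tildeLambda S z)).trace = p - n + z * ∑ i, 1 / tildeLambda S z i := by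
  have hn : (n : ℂ) ≠ 0 := by exact_mod_cast h.card_pos.ne'
  have him := h.tildeLambda_im_pos hz
  have h1 : tildeA S (tildeLambda S z) * tildeQ S (tildeLambda S z) = 1 :=
    Matrix.mul_nonsing_inv _ (isUnit_iff_ne_zero.2 (det_tildeA_ne_zero h.posSemidef him))
  have h2 := congrArg Matrix.trace h1
  rw [tildeA, Matrix.sub_mul, Matrix.one_mul, Matrix.trace_sub, Matrix.trace_one, Fintype.card_fin,
    Matrix.smul_mul, Matrix.trace_smul, Matrix.sum_mul, Matrix.trace_sum, smul_eq_mul, Finset.mul_sum] at h2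
  have h3 : ∀ i, (1 / (n : ℂ)) * (((1 / tildeLambda S z i) • (S i).map Complex.ofReal) *
      tildeQ S (tildeLambda S z)).trace = z * (1 / tildeLambda S z i) - 1 := fun i => by
    have h4 := (h.isSolution_tildeLambda hz).2 i
    have h5 := ne_zero_of_im_pos (him i)
    rw [Matrix.smul_mul, Matrix.trace_smul, smul_eq_mul]
    have h6 : 1 / (n : ℂ) * ((S i).map Complex.ofReal * tildeQ S (tildeLambda S z)).trace
        = z - tildeLambda S z i := by linear_combination h4
    rw [mul_left_comm, h6]
    field_simp
  simp_rw [h3] at h2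
  rw [Finset.sum_sub_distrib, ← Finset.mul_sum] at h2
  simp only [Finset.sum_const, Finset.card_univ, Fintype.card_fin, nsmul_eq_mul, mul_one] at h2
  linear_combination h2

/-- Since `tildeR` is `-(z A)⁻¹`, its trace is `-1 / z` times that of `Q`; the trace formula then
gives the transform of the signed combination of measures. -/
theorem tildeG_eq (hp : 0 < p) {z : ℂ} (hz : 0 < z.im) :
    tildeG S z = ((1 - (n : ℝ) / p : ℝ) : ℂ) * -(1 / z) +
      ((1 / (p : ℝ) : ℝ) : ℂ) * ∑ i, -1 / tildeLambda S z i := by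
  have hz0 := ne_zero_of_im_pos hz
  have hp' : (p : ℂ) ≠ 0 := by exact_mod_cast hp.ne'
  have hA := det_tildeA_ne_zero h.posSemidef (h.tildeLambda_im_pos hz)
  have h1 : tildeR S z = -(z • tildeA S (tildeLambda S z))⁻¹ := by
    have hX : (1 / (n : ℂ)) • ∑ i, (z / tildeLambda S z i) • (S i).map Complex.ofReal - z • 1
        = -(z • tildeA S (tildeLambda S z)) := by
      rw [tildeA, smul_sub, neg_sub, smul_comm z, Finset.smul_sum (r := z)]
      simp_rw [smul_smul, mul_one_div]
    rw [tildeR, hX]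
    refine Matrix.inv_eq_right_inv ?_
    rw [neg_mul_neg, Matrix.mul_nonsing_inv]
    rw [Matrix.det_smul]
    exact isUnit_iff_ne_zero.2 (mul_ne_zero (pow_ne_zero _ hz0) hA)
  have h2 : (tildeQ S (tildeLambda S z)).trace = -z * (tildeR S z).trace := by
    rw [tildeQ_eq_smul_inv hz0 hA, h1, Matrix.trace_smul, Matrix.trace_neg, smul_eq_mul]
    ring
  rw [h.trace_tildeQ hz] at h2
  have h3 : (tildeR S z).trace = -(1 / z) * (p - n + z * ∑ i, 1 / tildeLambda S z i) := by
    rw [h2]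
    field_simp
  rw [tildeG, h3]
  simp only [neg_div, Finset.sum_neg_distrib]
  push_cast
  field_simp
  ring

theorem im_tildeG_le (hp : 0 < p) {z : ℂ} (hz : 0 < z.im)
    (hB : z.re < 0 ∨ z.re ≠ 0 ∧ 4 * σ * (1 + κ) ≤ ‖z‖) :
    (tildeG S z).im ≤ (|1 - (n : ℝ) / p| + 8 * (n / p)) * (z.im / z.re ^ 2) := by
  have hre : z.re ≠ 0 := by
    rcases hB with hB | hB
    · exact hB.ne
    · exact hB.1
  have h1 : (-(1 / z)).im ≤ z.im / z.re ^ 2 := by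
    rw [im_neg_one_div, ← sq_abs z.re]
    gcongr
    exact Complex.abs_re_le_norm z
  have h0 : 0 ≤ (-(1 / z)).im := by
    rw [im_neg_one_div]
    positivity
  rw [h.tildeG_eq hp hz, Complex.add_im, Complex.im_ofReal_mul, Complex.im_ofReal_mul, Complex.im_sum, add_mul]
  refine add_le_add ?_ ?_
  · calc _ ≤ |1 - (n : ℝ) / p| * (-(1 / z)).im := by gcongr; exact le_abs_self _
      _ ≤ _ := by gcongr
  · calc _ ≤ 1 / (p : ℝ) * ∑ _ : Fin n, 8 * (z.im / z.re ^ 2) := by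
          gcongr
          exact h.im_neg_inv_tildeLambda_le hz hB _
      _ = _ := by
          rw [Finset.sum_const, Finset.card_univ, Fintype.card_fin, nsmul_eq_mul]
          ring

/-- The multiplicative constant in the bound on `Im tildeG` may depend on `n / p`: it only has to be
finite, and does not affect the radius. -/
theorem support_subset_Icc_of_isStieltjesTransform_tildeG (hp : 0 < p) (μ : Measure ℝ)
    [IsFiniteMeasure μ] (hμ : IsStieltjesTransform (tildeG S) μ) :
    μ.support ⊆ Icc 0 (4 * σ * (1 + κ)) :=
  support_subset_Icc_of_im_le μ hμ h.radius_nonneg (by positivity) fun _ hz hB => h.im_tildeG_le hp hz hB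

/-- On the imaginary axis admissibility says `Re Λ_i ≤ 0`, so `Re (-1 / Λ_i) ≥ 0` and the form of
`A` has nonnegative real part. -/
theorem re_trace_tildeQ_nonneg {y : ℝ} (hy : 0 < y) :
    0 ≤ (tildeQ S (tildeLambda S (y * I))).trace.re := by
  have hz : 0 < ((y : ℂ) * I).im := by simpa using hy
  rw [tildeQ_eq_inv]
  refine re_trace_inv_nonneg (det_tildeA_ne_zero h.posSemidef (h.tildeLambda_im_pos hz)) fun v => ?_
  have h1 := star_dotProduct_smul_tildeA_mulVec h.posSemidef 1 (tildeLambda S (y * I)) v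
  rw [one_smul, one_mul] at h1
  rw [h1, Complex.add_re, ofReal_re, Complex.re_sum]
  refine add_nonneg (by positivity) (Finset.sum_nonneg fun i _ => ?_)
  rw [Complex.re_ofReal_mul]
  refine mul_nonneg (div_nonneg (quadForm_nonneg (h.posSemidef i) v) n.cast_nonneg) ?_
  have h2 := (h.admissible_tildeLambda hz i).2
  simp only [mul_im, conj_re, conj_im, mul_re, ofReal_re, I_re, mul_zero, ofReal_im, I_im, mul_one,
    sub_self, add_zero] at h2
  rw [one_div, neg_re, Complex.inv_re, ← neg_div]
  refine div_nonneg ?_ (Complex.normSq_nonneg _)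
  nlinarith

/-- The masses at the origin compensate the negative coefficient `1 - n / p`. -/
theorem sub_le_sum_measureReal_singleton_zero {ν : Fin n → Measure ℝ}
    (hν : ∀ i, IsProbabilityMeasure (ν i))
    (hS : ∀ i, IsStieltjesTransform (fun z => -1 / tildeLambda S z i) (ν i)) :
    (n : ℝ) - p ≤ ∑ i, (ν i).real {0} := by
  have h1 : Tendsto (fun y : ℝ => ∑ i, -(y * I) * resolventTransform (ν i) (y * I : ℂ)) (𝓝[>] 0)
      (𝓝 (∑ i, ((ν i).real {0} : ℂ))) :=
    tendsto_finsetSum _ fun i _ => tendsto_neg_mul_resolventTransform_zero (ν i)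
  have h2 := (Complex.continuous_re.tendsto _).comp h1
  rw [← ofReal_sum, ofReal_re] at h2
  refine ge_of_tendsto h2 ?_
  filter_upwards [self_mem_nhdsWithin] with y hy
  have hz : 0 < ((y : ℂ) * I).im := by simpa using hy
  have h3 := h.re_trace_tildeQ_nonneg hy
  -- The quantity whose limit is the sum of the atoms at `0` equals `tr Q - (p - n)`, with `Re tr Q
  -- ≥ 0`.
  have h4 : ∑ i, -(y * I) * resolventTransform (ν i) (y * I : ℂ) =
      (tildeQ S (tildeLambda S (y * I))).trace - (((p : ℝ) - n : ℝ) : ℂ) := by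
    rw [h.trace_tildeQ hz, Finset.mul_sum]
    simp_rw [← hS _ _ hz]
    push_cast
    rw [add_sub_cancel_left]
    exact Finset.sum_congr rfl fun i _ => by ring
  rw [Function.comp_apply, h4, Complex.sub_re, ofReal_re]
  linarith

theorem exists_measure_tildeG (hp : 0 < p) : ∃ (μ : Measure ℝ) (ν : Fin n → Measure ℝ),
    IsProbabilityMeasure μ ∧ IsStieltjesTransform (tildeG S) μ ∧
    IsCompact μ.support ∧ μ.support ⊆ Ici 0 ∧
    (∀ i, IsProbabilityMeasure (ν i) ∧ (ν i).support ⊆ Ici 0 ∧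
      IsStieltjesTransform (fun z => -1 / tildeLambda S z i) (ν i)) ∧
    ∀ A : Set ℝ, MeasurableSet A →
      μ.real A = (1 - (n : ℝ) / p) * (Measure.dirac (0 : ℝ)).real A
        + (1 / (p : ℝ)) * ∑ i, (ν i).real A := by
  choose ν hν hsupp hνS using h.exists_measure_neg_inv_tildeLambda
  have hp' : (0 : ℝ) < p := by exact_mod_cast hp
  have hmass := h.sub_le_sum_measureReal_singleton_zero hν hνS
  set c : ℝ := 1 - (n : ℝ) / p + (1 / (p : ℝ)) * ∑ i, (ν i).real {0} with hc
  have hc0 : 0 ≤ c := by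
    have h1 : c = (1 / (p : ℝ)) * (p - n + ∑ i, (ν i).real {0}) := by
      rw [hc]
      field_simp
    rw [h1]
    exact mul_nonneg (by positivity) (by linarith)
  -- Removing the atoms of the `ν i` at the origin and collecting them with `1 - n/p` into the
  -- single weight `c ≥ 0` makes the signed combination visibly a positive measure.
  let μ : Measure ℝ := ENNReal.ofReal (1 / (p : ℝ)) • (∑ i, (ν i).restrict {0}ᶜ)
    + ENNReal.ofReal c • Measure.dirac 0
  have hsing : MeasurableSet ({0} : Set ℝ) := measurableSet_singleton 0
  have hreal : ∀ A : Set ℝ, MeasurableSet A →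
      μ.real A = (1 - (n : ℝ) / p) * (Measure.dirac (0 : ℝ)).real A
        + (1 / (p : ℝ)) * ∑ i, (ν i).real A := by
    intro A hA
    have h1 : ∀ i, (ν i).real A = ((ν i).restrict {0}ᶜ).real A
        + (ν i).real {0} * (Measure.dirac (0 : ℝ)).real A := fun i => by
      rw [measureReal_restrict_apply hA, ← measureReal_inter_add_sdiff (s := A) hsing,
        sdiff_eq, add_comm]
      congr 1
      by_cases h0 : (0 : ℝ) ∈ A
      · rw [inter_eq_self_of_subset_right (singleton_subset_iff.2 h0)]
        simp [measureReal_def, h0, hA]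
      · rw [inter_singleton_eq_empty.2 h0]
        simp [measureReal_def, h0, hA]
    have h2 : μ.real A = (1 / (p : ℝ)) * ∑ i, ((ν i).restrict {0}ᶜ).real A
        + c * (Measure.dirac (0 : ℝ)).real A := by
      simp only [μ, measureReal_def, Measure.add_apply, Measure.smul_apply, Measure.finsetSum_apply, smul_eq_mul]
      rw [ENNReal.toReal_add, ENNReal.toReal_mul, ENNReal.toReal_mul, ENNReal.toReal_ofReal (by positivity),
        ENNReal.toReal_ofReal hc0, ENNReal.toReal_sum]
      · exact fun i _ => measure_ne_top _ _
      · exact ENNReal.mul_ne_top ENNReal.ofReal_ne_top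
          (ENNReal.sum_ne_top.2 fun i _ => measure_ne_top _ _)
      · exact ENNReal.mul_ne_top ENNReal.ofReal_ne_top (measure_ne_top _ _)
    rw [h2, Finset.sum_congr rfl fun i _ => h1 i, Finset.sum_add_distrib, ← Finset.sum_mul, hc]
    ring
  have hfin : IsFiniteMeasure μ := by
    have : IsFiniteMeasure (ENNReal.ofReal (1 / (p : ℝ)) • (∑ i, (ν i).restrict {0}ᶜ)) :=
      Measure.smul_finite _ ENNReal.ofReal_ne_top
    have : IsFiniteMeasure (ENNReal.ofReal c • Measure.dirac (0 : ℝ)) :=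
      Measure.smul_finite _ ENNReal.ofReal_ne_top
    infer_instance
  have hprob : IsProbabilityMeasure μ := by
    refine ⟨(ENNReal.toReal_eq_one_iff _).1 ?_⟩
    have h1 := hreal univ MeasurableSet.univ
    simp only [probReal_univ, Finset.sum_const, Finset.card_univ, Fintype.card_fin, nsmul_eq_mul, mul_one] at h1
    rw [measureReal_def] at h1
    rw [h1]
    field_simp
    ring
  have hμS : IsStieltjesTransform (tildeG S) μ := fun z hz => by
    have hint : ∀ (τ : Measure ℝ) [IsFiniteMeasure τ], Integrable (fun x : ℝ => ((x : ℂ) - z)⁻¹) τ :=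
      fun τ _ => integrable_inv_ofReal_sub τ hz
    have h1 : ∀ i, -1 / tildeLambda S z i = ∫ x, ((x : ℂ) - z)⁻¹ ∂(ν i).restrict {0}ᶜ
        + ((ν i).real {0} : ℂ) * -(1 / z) := fun i => by
      rw [show -1 / tildeLambda S z i = _ from hνS i z hz, resolventTransform_eq_integral_inv, ← integral_add_compl hsing (hint (ν i)), add_comm,
        integral_singleton]
      simp
    rw [h.tildeG_eq hp hz, resolventTransform_eq_integral_inv, integral_add_measure, integral_smul_measure,
      integral_smul_measure, integral_finsetSum_measure, integral_dirac, Finset.sum_congr rfl fun i _ => h1 i,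
      Finset.sum_add_distrib, ← Finset.sum_mul, ENNReal.toReal_ofReal (by positivity),
      ENNReal.toReal_ofReal hc0, hc, Complex.real_smul, Complex.real_smul, ofReal_zero, zero_sub, inv_neg,
      one_div z]
    · push_cast
      ring
    · exact fun i _ => hint _
    · exact (integrable_finsetSum_measure.2 fun i _ => hint _).smul_measure ENNReal.ofReal_ne_top
    · exact (hint _).smul_measure ENNReal.ofReal_ne_top
  have hsub := h.support_subset_Icc_of_isStieltjesTransform_tildeG hp μ hμS
  exact ⟨μ, ν, hprob, hμS, isCompact_Icc.of_isClosed_subset Measure.isClosed_support hsub,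
    hsub.trans Icc_subset_Ici_self, fun i => ⟨hν i, (hsupp i).trans Icc_subset_Ici_self, hνS i⟩, hreal⟩

end IsBoundedFamily

end SampleCovariance

/-! ### Concentration bounds the norms of the second moment matrices. -/

namespace SampleCovariance

open Filter Topology Complex Set
open scoped Matrix Matrix.Norms.L2Operator ENNReal

theorem exists_eq_transpose_mul_self {p : ℕ} {T : Matrix (Fin p) (Fin p) ℝ} (hT : T.PosSemidef) :
    ∃ N : Matrix (Fin p) (Fin p) ℝ, T = Nᵀ * N := by
  obtain ⟨N, hN⟩ := exists_map_eq_conjTranspose_mul_self hT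
  refine ⟨N, Matrix.map_injective Complex.ofReal_injective ?_⟩
  simp only [hN, conjTranspose_map_ofReal]
  ext a b
  simp [Matrix.mul_apply]

/-- Since `T = Nᵀ N` with `N` real, the bound on real vectors extends to complex ones through real
and imaginary parts, and the C*-identity gives the norm of `T`. -/
theorem l2_opNorm_map_ofReal_le {p : ℕ} {T : Matrix (Fin p) (Fin p) ℝ} (hT : T.PosSemidef) {σ : ℝ}
    (hσ : 0 ≤ σ) (h : ∀ u : Fin p → ℝ, u ⬝ᵥ T *ᵥ u ≤ σ * ∑ k, u k ^ 2) :
    ‖T.map Complex.ofReal‖ ≤ σ := by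
  obtain ⟨N, hN⟩ := exists_eq_transpose_mul_self hT
  have hreal : ∀ u : Fin p → ℝ, ∑ k, (N *ᵥ u) k ^ 2 ≤ σ * ∑ k, u k ^ 2 := fun u => by
    refine le_trans (le_of_eq ?_) (h u)
    rw [hN, ← Matrix.mulVec_mulVec, Matrix.dotProduct_mulVec, Matrix.vecMul_transpose]
    simp [dotProduct, sq]
  have hNorm : ‖N.map Complex.ofReal‖ ≤ Real.sqrt σ := by
    refine l2_opNorm_le_of_forall (Real.sqrt_nonneg _) fun v => ?_
    rw [Real.sq_sqrt hσ]
    have h1 : ∀ k, ‖(N.map Complex.ofReal *ᵥ v) k‖ ^ 2 =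
        (N *ᵥ fun l => (v l).re) k ^ 2 + (N *ᵥ fun l => (v l).im) k ^ 2 := fun k => by
      rw [← Complex.normSq_eq_norm_sq, Complex.normSq_apply]
      simp only [Matrix.mulVec, dotProduct, Matrix.map_apply, Complex.re_sum, Complex.im_sum,
        Complex.re_ofReal_mul, Complex.im_ofReal_mul, sq]
    have h2 : ∀ k, ‖v k‖ ^ 2 = (v k).re ^ 2 + (v k).im ^ 2 := fun k => by
      rw [← Complex.normSq_eq_norm_sq, Complex.normSq_apply, sq, sq]
    simp_rw [h1, h2, Finset.sum_add_distrib, mul_add]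
    exact add_le_add (hreal _) (hreal _)
  have hmap : T.map Complex.ofReal = (N.map Complex.ofReal)ᴴ * N.map Complex.ofReal := by
    rw [conjTranspose_map_ofReal, hN]
    ext a b
    simp [Matrix.mul_apply]
  rw [hmap, Matrix.l2_opNorm_conjTranspose_mul_self, ← Real.mul_self_sqrt hσ]
  exact mul_le_mul hNorm hNorm (norm_nonneg _) (Real.sqrt_nonneg _)

/-- The bound on the variance provided by Gaussian concentration with constants `C` and `c`. -/
noncomputable def varianceBound (C c : ℝ) : ℝ :=
  ∫ t : ℝ in Ioi 0, 2 * |C| * (t * Real.exp (-(c ^ 2)⁻¹ * t ^ 2))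

theorem varianceBound_nonneg (C c : ℝ) : 0 ≤ varianceBound C c :=
  setIntegral_nonneg measurableSet_Ioi fun t (ht : 0 < t) => by positivity

section Concentration

variable {Ω : Type*} [MeasurableSpace Ω] {P : Measure Ω}

/-- Layer-cake formula with weight `2 t`. The centre `m` is arbitrary and the integral is a lower
Lebesgue integral, so no integrability of `Y` is presupposed. -/
theorem lintegral_sq_sub_le [IsProbabilityMeasure P] {Y : Ω → ℝ} (hY : Measurable Y) {m C c : ℝ} (hc : 0 < c)
    (h : ∀ t : ℝ, 0 < t → P.real {ω | t ≤ |Y ω - m|} ≤ C * Real.exp (-(t / c) ^ 2)) :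
    ∫⁻ ω, ENNReal.ofReal ((Y ω - m) ^ 2) ∂P ≤ ENNReal.ofReal (varianceBound C c) := by
  have hlayer := lintegral_comp_eq_lintegral_meas_le_mul P (f := fun ω => |Y ω - m|) (g := fun t => 2 * t)
    (ae_of_all _ fun ω => abs_nonneg _) (by fun_prop)
    (fun t _ => (continuous_const.mul continuous_id).intervalIntegrable _ _)
    (by
      filter_upwards [self_mem_ae_restrict measurableSet_Ioi] with t ht
      exact mul_nonneg zero_le_two (le_of_lt ht))
  have h1 : ∀ ω, (∫ t in (0 : ℝ)..|Y ω - m|, 2 * t) = (Y ω - m) ^ 2 := fun ω => by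
    rw [intervalIntegral.integral_const_mul, integral_id]
    rw [sq_abs]
    ring
  simp_rw [h1] at hlayer
  have hint : IntegrableOn (fun t : ℝ => 2 * |C| * (t * Real.exp (-(c ^ 2)⁻¹ * t ^ 2))) (Ioi 0) :=
    ((integrable_mul_exp_neg_mul_sq (by positivity : 0 < (c ^ 2)⁻¹)).const_mul _).integrableOn
  rw [hlayer, varianceBound, ofReal_integral_eq_lintegral_ofReal hint]
  · refine setLIntegral_mono' measurableSet_Ioi fun t (ht : 0 < t) => ?_
    rw [← ofReal_measureReal, ← ENNReal.ofReal_mul measureReal_nonneg]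
    refine ENNReal.ofReal_le_ofReal ?_
    have h2 : P.real {ω | t ≤ |Y ω - m|} ≤ |C| * Real.exp (-(c ^ 2)⁻¹ * t ^ 2) := by
      refine (h t ht).trans ?_
      have : -(t / c) ^ 2 = -(c ^ 2)⁻¹ * t ^ 2 := by rw [div_pow]; ring
      rw [this]
      gcongr
      exact le_abs_self C
    calc _ ≤ |C| * Real.exp (-(c ^ 2)⁻¹ * t ^ 2) * (2 * t) := by gcongr
      _ = _ := by ring
  · filter_upwards [self_mem_ae_restrict measurableSet_Ioi] with t ht
    have : (0 : ℝ) < t := ht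
    change 0 ≤ 2 * |C| * (t * Real.exp (-(c ^ 2)⁻¹ * t ^ 2))
    positivity

theorem memLp_two_of_concentration [IsProbabilityMeasure P] {Y : Ω → ℝ} (hY : Measurable Y) {m C c : ℝ} (hc : 0 < c)
    (h : ∀ t : ℝ, 0 < t → P.real {ω | t ≤ |Y ω - m|} ≤ C * Real.exp (-(t / c) ^ 2)) :
    MemLp Y 2 P := by
  have h1 : Integrable (fun ω => (Y ω - m) ^ 2) P := by
    refine ⟨by fun_prop, ?_⟩
    rw [hasFiniteIntegral_iff_ofReal (ae_of_all _ fun ω => sq_nonneg _)]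
    exact (lintegral_sq_sub_le hY hc h).trans_lt ENNReal.ofReal_lt_top
  have h2 : MemLp (fun ω => Y ω - m) 2 P :=
    (memLp_two_iff_integrable_sq (by fun_prop)).2 h1
  exact (h2.add (memLp_const m)).ae_eq (ae_of_all _ fun ω => sub_add_cancel (Y ω) m)

theorem integral_sq_le_of_concentration [IsProbabilityMeasure P] {Y : Ω → ℝ} (hY : Measurable Y) {C c : ℝ} (hc : 0 < c)
    (h : ∀ t : ℝ, 0 < t → P.real {ω | t ≤ |Y ω - ∫ ω', Y ω' ∂P|} ≤ C * Real.exp (-(t / c) ^ 2)) :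
    ∫ ω, Y ω ^ 2 ∂P ≤ 2 * varianceBound C c + 2 * (∫ ω, Y ω ∂P) ^ 2 := by
  set m := ∫ ω, Y ω ∂P
  have hmem := memLp_two_of_concentration hY hc h
  have hsub : Integrable (fun ω => (Y ω - m) ^ 2) P := (hmem.sub (memLp_const m)).integrable_sq
  have h1 : ∫ ω, (Y ω - m) ^ 2 ∂P ≤ varianceBound C c := by
    rw [integral_eq_lintegral_of_nonneg_ae (ae_of_all _ fun ω => sq_nonneg _) (by fun_prop)]
    exact ENNReal.toReal_le_of_le_ofReal (varianceBound_nonneg C c) (lintegral_sq_sub_le hY hc h)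
  calc ∫ ω, Y ω ^ 2 ∂P ≤ ∫ ω, (2 * (Y ω - m) ^ 2 + 2 * m ^ 2) ∂P := by
        refine integral_mono hmem.integrable_sq ((hsub.const_mul 2).add (integrable_const _)) fun ω => ?_
        change Y ω ^ 2 ≤ 2 * (Y ω - m) ^ 2 + 2 * m ^ 2
        nlinarith [sq_nonneg (Y ω - 2 * m)]
    _ = 2 * ∫ ω, (Y ω - m) ^ 2 ∂P + 2 * m ^ 2 := by
        rw [integral_add (hsub.const_mul 2) (integrable_const _), integral_const_mul]
        simp
    _ ≤ _ := by gcongr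

variable {n p : ℕ} {X : Ω → Matrix (Fin p) (Fin n) ℝ} {C c : ℝ}

/-- By Cauchy-Schwarz, pairing one column with a unit vector is `1`-Lipschitz for the Frobenius
norm. -/
theorem IsConcentrated.linear (hX : IsConcentrated P X C c) (i : Fin n) {u : Fin p → ℝ}
    (hu : ∑ k, u k ^ 2 = 1) (t : ℝ) (ht : 0 < t) :
    P.real {ω | t ≤ |∑ k, u k * X ω k i - ∫ ω', ∑ k, u k * X ω' k i ∂P|} ≤
      C * Real.exp (-(t / c) ^ 2) := by
  refine hX (fun A => ∑ k, u k * A k i) (fun A B => ?_) t ht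
  rw [← Finset.sum_sub_distrib]
  refine Real.abs_le_sqrt ?_
  calc (∑ k, (u k * A k i - u k * B k i)) ^ 2 = (∑ k, u k * (A k i - B k i)) ^ 2 := by
        simp_rw [mul_sub]
    _ ≤ (∑ k, u k ^ 2) * ∑ k, (A k i - B k i) ^ 2 := Finset.sum_mul_sq_le_sq_mul_sq _ _ _
    _ = ∑ k, (A k i - B k i) ^ 2 := by rw [hu, one_mul]
    _ ≤ _ := Finset.sum_le_sum fun k _ =>
        Finset.single_le_sum (f := fun j => (A k j - B k j) ^ 2) (fun j _ => sq_nonneg _) (Finset.mem_univ i)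

/-- The centre in the concentration hypothesis could be the default value `0` of a nonexistent
expectation. Square integrability holds for any centre, and afterwards all expectations are genuine.
-/
theorem IsConcentrated.memLp_entry [IsProbabilityMeasure P] (hX : IsConcentrated P X C c) (hc : 0 < c)
    (hm : ∀ k i, Measurable fun ω => X ω k i) (k : Fin p) (i : Fin n) :
    MemLp (fun ω => X ω k i) 2 P := by
  have h := hX.linear i (u := Pi.single k 1) (by simp [Pi.single_apply])
  simp only [Pi.single_apply, ite_mul, one_mul, zero_mul, Finset.sum_ite_eq', Finset.mem_univ, if_true] at h
  exact memLp_two_of_concentration (hm k i) hc h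

theorem dotProduct_secondMoment_mulVec
    (hL2 : ∀ k i, MemLp (fun ω => X ω k i) 2 P) (i : Fin n) (u : Fin p → ℝ) :
    u ⬝ᵥ secondMoment P X i *ᵥ u = ∫ ω, (∑ k, u k * X ω k i) ^ 2 ∂P := by
  have hint : ∀ k l, Integrable (fun ω => X ω k i * X ω l i) P := fun k l =>
    (hL2 k i).integrable_mul (hL2 l i)
  have h1 : ∀ ω, (∑ k, u k * X ω k i) ^ 2 = ∑ k, ∑ l, u k * u l * (X ω k i * X ω l i) := fun ω => by
    rw [sq, Finset.sum_mul_sum]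
    exact Finset.sum_congr rfl fun k _ => Finset.sum_congr rfl fun l _ => by ring
  simp_rw [h1]
  rw [integral_finsetSum _ fun k _ => integrable_finsetSum _ fun l _ => (hint k l).const_mul _]
  simp only [dotProduct, Matrix.mulVec, secondMoment, Matrix.of_apply]
  refine Finset.sum_congr rfl fun k _ => ?_
  rw [integral_finsetSum _ fun l _ => (hint k l).const_mul _, Finset.mul_sum]
  refine Finset.sum_congr rfl fun l _ => ?_
  rw [integral_const_mul]
  ring

theorem posSemidef_secondMoment (hL2 : ∀ k i, MemLp (fun ω => X ω k i) 2 P) (i : Fin n) :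
    (secondMoment P X i).PosSemidef := by
  refine Matrix.PosSemidef.of_dotProduct_mulVec_nonneg ?_ fun u => ?_
  · ext k l
    simp [secondMoment, mul_comm]
  · rw [star_trivial, dotProduct_secondMoment_mulVec hL2]
    exact integral_nonneg fun ω => sq_nonneg _

/-- For a unit vector the form is the second moment of a concentrated linear functional whose mean
is at most `M` in absolute value; homogeneity gives the rest. -/
theorem dotProduct_secondMoment_mulVec_le [IsProbabilityMeasure P] (hX : IsConcentrated P X C c) (hc : 0 < c)
    (hm : ∀ k i, Measurable fun ω => X ω k i) {M : ℝ} (i : Fin n)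
    (hM : Real.sqrt (∑ k, (∫ ω, X ω k i ∂P) ^ 2) ≤ M) (u : Fin p → ℝ) :
    u ⬝ᵥ secondMoment P X i *ᵥ u ≤ (2 * varianceBound C c + 2 * M ^ 2) * ∑ k, u k ^ 2 := by
  have hL2 := hX.memLp_entry hc hm
  have hM2 : ∑ k, (∫ ω, X ω k i ∂P) ^ 2 ≤ M ^ 2 := (Real.sqrt_le_left
    ((Real.sqrt_nonneg _).trans hM)).1 hM
  have unit : ∀ w : Fin p → ℝ, ∑ k, w k ^ 2 = 1 →
      w ⬝ᵥ secondMoment P X i *ᵥ w ≤ 2 * varianceBound C c + 2 * M ^ 2 := fun w hw => by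
    rw [dotProduct_secondMoment_mulVec hL2]
    refine (integral_sq_le_of_concentration (by fun_prop) hc (hX.linear i hw)).trans ?_
    refine add_le_add_right (mul_le_mul_of_nonneg_left ?_ zero_le_two) _
    rw [integral_finsetSum _ fun k _ => ((hL2 k i).integrable one_le_two).const_mul _]
    simp_rw [integral_const_mul]
    refine (Finset.sum_mul_sq_le_sq_mul_sq _ _ _).trans ?_
    rwa [hw, one_mul]
  rcases (Finset.sum_nonneg fun k _ => sq_nonneg (u k) : 0 ≤ ∑ k, u k ^ 2).eq_or_lt with h0 | h0
  · have hu : u = 0 := by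
      ext k
      have := (Finset.sum_eq_zero_iff_of_nonneg fun k _ => sq_nonneg (u k)).1 h0.symm k (Finset.mem_univ k)
      exact pow_eq_zero_iff two_ne_zero |>.1 this
    simp [hu]
  · set r := ∑ k, u k ^ 2
    have h1 := unit ((Real.sqrt r)⁻¹ • u) (by
      simp only [Pi.smul_apply, smul_eq_mul, mul_pow, inv_pow, Real.sq_sqrt h0.le, ← Finset.mul_sum]
      exact inv_mul_cancel₀ h0.ne')
    rw [Matrix.mulVec_smul, dotProduct_smul, smul_dotProduct, smul_smul, ← mul_inv, Real.mul_self_sqrt h0.le,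
      smul_eq_mul, inv_mul_le_iff₀ h0] at h1
    linarith

theorem isBoundedFamily_secondMoment [IsProbabilityMeasure P] (hX : IsConcentrated P X C c) (hc : 0 < c)
    (hm : ∀ k i, Measurable fun ω => X ω k i) {M K : ℝ} (hn : 0 < n) (hK : (p : ℝ) ≤ K * n)
    (hM : ∀ i, Real.sqrt (∑ k, (∫ ω, X ω k i ∂P) ^ 2) ≤ M) :
    IsBoundedFamily (secondMoment P X) (max K 0) (2 * varianceBound C c + 2 * M ^ 2) := by
  have hσ : 0 ≤ 2 * varianceBound C c + 2 * M ^ 2 := by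
    have := varianceBound_nonneg C c
    positivity
  have hpsd := posSemidef_secondMoment (hX.memLp_entry hc hm)
  refine ⟨hn, hpsd, le_max_right _ _, hK.trans ?_, hσ, fun i => ?_⟩
  · gcongr
    exact le_max_left _ _
  · exact l2_opNorm_map_ofReal_le (hpsd i) hσ (dotProduct_secondMoment_mulVec_le hX hc hm i (hM i))

end Concentration

end SampleCovariance

theorem theorem2 :
    (∀ (n p : ℕ) (S : Fin n → Matrix (Fin p) (Fin p) ℝ), 0 < n → 0 < p →
      (∀ i, (S i).PosSemidef) →
      (∀ z : ℂ, 0 < z.im → ∃! L : Fin n → ℂ, SampleCovariance.IsSolution S z L) ∧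
      (∀ z : ℂ, 0 < z.im →
        SampleCovariance.IsSolution S z (SampleCovariance.tildeLambda S z)) ∧
      AnalyticOnNhd ℂ (SampleCovariance.tildeLambda S) {z : ℂ | 0 < z.im} ∧
      ∃ (μ : MeasureTheory.Measure ℝ) (ν : Fin n → MeasureTheory.Measure ℝ),
        MeasureTheory.IsProbabilityMeasure μ ∧
        SampleCovariance.IsStieltjesTransform (SampleCovariance.tildeG S) μ ∧
        IsCompact μ.support ∧ μ.support ⊆ Set.Ici 0 ∧
        (∀ i, MeasureTheory.IsProbabilityMeasure (ν i) ∧ (ν i).support ⊆ Set.Ici 0 ∧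
          SampleCovariance.IsStieltjesTransform
            (fun z => -1 / SampleCovariance.tildeLambda S z i) (ν i)) ∧
        ∀ A : Set ℝ, MeasurableSet A →
          μ.real A = (1 - (n : ℝ) / p) * (MeasureTheory.Measure.dirac (0 : ℝ)).real A
            + (1 / (p : ℝ)) * ∑ i, (ν i).real A) ∧
    (∀ K C c M : ℝ, 0 < c → ∃ B : ℝ,
      ∀ (n p : ℕ) (Ω : Type*) [MeasurableSpace Ω] (P : MeasureTheory.Measure Ω)
        [MeasureTheory.IsProbabilityMeasure P] (X : Ω → Matrix (Fin p) (Fin n) ℝ),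
        0 < n → 0 < p → (p : ℝ) ≤ K * n →
        (∀ k i, Measurable fun ω => X ω k i) →
        SampleCovariance.IsConcentrated P X C c →
        (∀ i, Real.sqrt (∑ k, (∫ ω, X ω k i ∂P) ^ 2) ≤ M) →
        ∀ μ : MeasureTheory.Measure ℝ, MeasureTheory.IsFiniteMeasure μ →
          SampleCovariance.IsStieltjesTransform
            (SampleCovariance.tildeG (SampleCovariance.secondMoment P X)) μ →
          μ.support ⊆ Set.Icc 0 B) := by
  -- The bound `B` is the radius `4σ(1 + κ)` with the values of `σ` and `κ` provided by
  -- `isBoundedFamily_secondMoment`; `max K 0` is used since `B` is fixed before any `n`, `p` force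
  -- `K ≥ 0`.
  refine ⟨fun n p S hn hp hS => ?_, fun K C c M hc =>
    ⟨4 * (2 * SampleCovariance.varianceBound C c + 2 * M ^ 2) * (1 + max K 0), ?_⟩⟩
  · obtain ⟨κ, σ, h⟩ := SampleCovariance.exists_isBoundedFamily hn hS
    exact ⟨fun z hz => h.existsUnique_isSolution hz, fun z hz => h.isSolution_tildeLambda hz,
      h.analyticOnNhd_tildeLambda, h.exists_measure_tildeG hp⟩
  · intro n p Ω _ P _ X hn hp hK hm hX hM μ _ hμ
    exact (SampleCovariance.isBoundedFamily_secondMoment hX hc hm hn hK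
      hM).support_subset_Icc_of_isStieltjesTransform_tildeG hp μ hμ
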